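/- **Theorem 1.3.** Let $n\ge 1$, $r,s\ge 0$, and let $\eta=(n_1,\dots,n_r;m_1,\dots,m_s)$ be positive integers with $(n_1+\dots+n_r)+2(m_1+\dots+m_s)=n$. Let $\mathbb{T}_m(\mathbb{R})$ be the set of lower triangular real $m\times m$ matrices with all diagonal entries equal; let $\mathbb{S}$ be the set of real matrices $\begin{bmatrix}\alpha&\beta\\-\beta&\alpha\end{bmatrix}$; let $\mathbb{B}_m(\mathbb{R})$ be the set of real $2m\times 2m$ matrices that, written as $m\times m$ arrays of $2\times2$ cells, are lower triangular with cells in $\mathbb{S}$ and all diagonal cells equal. Put $$\mathcal{K}=\mathbb{T}_{n_1}(\mathbb{R})\oplus\dots\oplus\mathbb{T}_{n_r}(\mathbb{R})\oplus\mathbb{B}_{m_1}(\mathbb{R})\oplus\dots\oplus\mathbb{B}_{m_s}(\mathbb{R})\subset M_n(\mathbb{R})$$ (block diagonal matrices). Let $u_0\in\mathbb{R}^n$ be the vector whose first coordinate in each of the $r+s$ blocks is $1$ and whose other coordinates are $0$, and let $f^{(l)}\in\mathbb{R}^n$ ($1\le l\le s$) be the vector whose only nonzero coordinate is a $1$ in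 the second place of the block of size $2m_l$. Let $G$ be an abelian sub-semigroup of $M_n(\mathbb{R})$ and $P\in GL(n,\mathbb{R})$ with $P^{-1}GP\subset\mathcal{K}$; put $v_0=Pu_0$. Write $\mathrm{g}=\{B\in P\mathcal{K}P^{-1}: e^B\in G\}$ and $\mathrm{g}^2=\{B\in P\mathcal{K}P^{-1}: e^B=A^2\text{ for some }A\in G\}$, and, for $v\in\mathbb{R}^n$, $G(v)=\{Av:A\in G\}$ and $\mathrm{g}^2_{v}=\{Bv:B\in\mathrm{g}^2\}$. A set $E\subset\mathbb{R}^n$ is *locally dense* if its closure has nonempty interior, and $G$ is *locally hypercyclic* if $G(v)$ is locally dense for some $v\in\mathbb{R}^n$. Let $A_1,\dots,A_p$ generate $G$ (as a semigroup, or as a semigroup with identity $I_n$), and let $B_1,\dots,B_p\in\mathrm{g}$ be such that $A_k^2=e^{B_k}$ for $k=1,\dots,p$. With $\mathbb{N}=\{0,1,2,\dots\}$, put $$H=\sum_{k=1}^p\mathbb{N}B_kv_0+\sum_{l=1}^s2\pi\mathbb{Z}Pf^{(l)},$$ an additive sub-semigroup of $\mathbb{R}^n$. If $I_n\in G$, then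 $\mathrm{g}^2_{v_0}=H$. Moreover, whether or not $I_n\in G$, the following are equivalent: 1. $G$ is locally hypercyclic; 2. $G(v_0)$ is locally dense in $\mathbb{R}^n$; 3. $\mathrm{g}^2_{v_0}$ is an additive sub-semigroup of $\mathbb{R}^n$ that is dense in $\mathbb{R}^n$; 4. $H$ is dense in $\mathbb{R}^n$. -/

import Mathlib

noncomputable section

namespace AbelianSemigroup

open Matrix

/-- A block shape `η = (n₁,…,n_r; m₁,…,m_s)` of size `n`: a sequence of positive integers with
`(n₁ + ⋯ + n_r) + 2 (m₁ + ⋯ + m_s) = n`. -/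
structure Shape (n r s : ℕ) where
  /-- the sizes `n₁,…,n_r` of the real blocks -/
  nn : Fin r → ℕ
  /-- the half-sizes `m₁,…,m_s` of the complex blocks -/
  mm : Fin s → ℕ
  nn_pos : ∀ k, 0 < nn k
  mm_pos : ∀ l, 0 < mm l
  sum_eq : (∑ k, nn k) + 2 * (∑ l, mm l) = n

/-- The index type of the block decomposition: `r` real blocks of sizes `n_k`, followed by `s`
blocks of sizes `2 m_l`, the latter made of `2 × 2` cells. -/
abbrev BlockIndex {n r s : ℕ} (η : Shape n r s) : Type :=
  (Σ k : Fin r, Fin (η.nn k)) ⊕ (Σ l : Fin s, Fin (η.mm l) × Fin 2)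

/-- The order-preserving numbering of the block coordinates by `1,…,n` (here `0,…,n-1`): the real
blocks come first, in order, then the complex blocks, in order, and inside a complex block the
coordinate `(i, c)` has position `2 i + c`. -/
def blockEquiv {n r s : ℕ} (η : Shape n r s) : BlockIndex η ≃ Fin n :=
  ((Equiv.sumCongr finSigmaFinEquiv
      ((Equiv.sigmaCongrRight fun l => finProdFinEquiv (m := η.mm l) (n := 2)).trans
        finSigmaFinEquiv)).trans finSumFinEquiv).trans
    (finCongr (by rw [← Finset.sum_mul, mul_comm, η.sum_eq]))

/-- `𝕋_m(ℝ)`: lower triangular real `m × m` matrices with constant diagonal. -/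
def triangularBlocks (m : ℕ) : Set (Matrix (Fin m) (Fin m) ℝ) :=
  {M | ∃ μ : ℝ, (∀ i, M i i = μ) ∧ ∀ i j, i < j → M i j = 0}

/-- `𝕊`: the real `2 × 2` matrices `[[α, β], [-β, α]]`. -/
def complexCells : Set (Matrix (Fin 2) (Fin 2) ℝ) :=
  {C | ∃ α β : ℝ, C = !![α, β; -β, α]}

/-- The `(i, j)` cell, of size `2 × 2`, of a `2m × 2m` matrix. -/
def cell {m : ℕ} (M : Matrix (Fin m × Fin 2) (Fin m × Fin 2) ℝ) (i j : Fin m) :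
    Matrix (Fin 2) (Fin 2) ℝ :=
  Matrix.of fun a b => M (i, a) (j, b)

/-- `𝔹_m(ℝ)`: real `2m × 2m` matrices whose cells lie in `𝕊`, lower triangular in cells, and with
the same cell `C` everywhere on the diagonal. -/
def complexTriangularBlocks (m : ℕ) : Set (Matrix (Fin m × Fin 2) (Fin m × Fin 2) ℝ) :=
  {M | ∃ C ∈ complexCells, (∀ i, cell M i i = C) ∧ (∀ i j, i < j → cell M i j = 0) ∧
    ∀ i j, j < i → cell M i j ∈ complexCells}

/-- `𝒦_{η,r,s}(ℝ) = 𝕋_{n₁}(ℝ) ⊕ ⋯ ⊕ 𝕋_{n_r}(ℝ) ⊕ 𝔹_{m₁}(ℝ) ⊕ ⋯ ⊕ 𝔹_{m_s}(ℝ)`, as a set of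
`n × n` matrices. -/
def normalMatrices {n r s : ℕ} (η : Shape n r s) : Set (Matrix (Fin n) (Fin n) ℝ) :=
  {M | ∃ (T : ∀ k, Matrix (Fin (η.nn k)) (Fin (η.nn k)) ℝ)
      (S : ∀ l, Matrix (Fin (η.mm l) × Fin 2) (Fin (η.mm l) × Fin 2) ℝ),
      (∀ k, T k ∈ triangularBlocks (η.nn k)) ∧
      (∀ l, S l ∈ complexTriangularBlocks (η.mm l)) ∧
      M = Matrix.reindex (blockEquiv η) (blockEquiv η)
        (Matrix.fromBlocks (Matrix.blockDiagonal' T) 0 0 (Matrix.blockDiagonal' S))}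

/-- `P 𝒦_{η,r,s}(ℝ) P⁻¹`. -/
def conjNormalMatrices {n r s : ℕ} (η : Shape n r s) (P : GL (Fin n) ℝ) :
    Set (Matrix (Fin n) (Fin n) ℝ) :=
  {X | ∃ M ∈ normalMatrices η, X = P.val * M * (P⁻¹).val}

/-- `u₀ = [e_{1,1},…,e_{r,1}; f_{1,1},…,f_{s,1}]ᵀ`: in every block the first coordinate is `1`, and
all the others are `0`. -/
def uZero {n r s : ℕ} (η : Shape n r s) : Fin n → ℝ := fun i =>
  Sum.elim (fun x : Σ k : Fin r, Fin (η.nn k) => if x.2.val = 0 then (1 : ℝ) else 0)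
    (fun x : Σ l : Fin s, Fin (η.mm l) × Fin 2 =>
      if x.2.1.val = 0 ∧ x.2.2 = 0 then (1 : ℝ) else 0)
    ((blockEquiv η).symm i)

/-- `v₀ = P u₀`. -/
def vZero {n r s : ℕ} (η : Shape n r s) (P : GL (Fin n) ℝ) : Fin n → ℝ :=
  P.val *ᵥ uZero η

/-- `f^{(l)}`: the vector whose only nonzero coordinate is a `1` in the second place of the `l`-th
complex block. -/
def fVec {n r s : ℕ} (η : Shape n r s) (l : Fin s) : Fin n → ℝ := fun i =>
  Sum.elim (fun _ : Σ k : Fin r, Fin (η.nn k) => (0 : ℝ))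
    (fun x : Σ l : Fin s, Fin (η.mm l) × Fin 2 =>
      if x.1 = l ∧ x.2.1.val = 0 ∧ x.2.2 = 1 then (1 : ℝ) else 0)
    ((blockEquiv η).symm i)

/-- `{X v : X ∈ S}`; this is the orbit `G(v)` for `S = G`, and `g_v` for `S = g`. -/
def orbit {n : ℕ} (S : Set (Matrix (Fin n) (Fin n) ℝ)) (v : Fin n → ℝ) : Set (Fin n → ℝ) :=
  (fun X => X *ᵥ v) '' S

/-- A subset of `ℝⁿ` is locally dense if its closure has nonempty interior. -/
def LocallyDense {n : ℕ} (E : Set (Fin n → ℝ)) : Prop :=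
  (interior (closure E)).Nonempty

/-- A semigroup of matrices is locally hypercyclic if it has a locally dense orbit. -/
def LocallyHypercyclic {n : ℕ} (G : Subsemigroup (Matrix (Fin n) (Fin n) ℝ)) : Prop :=
  ∃ v : Fin n → ℝ, LocallyDense (orbit (G : Set (Matrix (Fin n) (Fin n) ℝ)) v)

/-- `exp⁻¹(S) ∩ P 𝒦_{η,r,s}(ℝ) P⁻¹`. -/
def logSet {n r s : ℕ} (η : Shape n r s) (P : GL (Fin n) ℝ)
    (S : Set (Matrix (Fin n) (Fin n) ℝ)) : Set (Matrix (Fin n) (Fin n) ℝ) :=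
  {B | NormedSpace.exp B ∈ S} ∩ conjNormalMatrices η P

/-- `g = exp⁻¹(G) ∩ P 𝒦_{η,r,s}(ℝ) P⁻¹`. -/
def gSet {n r s : ℕ} (η : Shape n r s) (P : GL (Fin n) ℝ)
    (G : Subsemigroup (Matrix (Fin n) (Fin n) ℝ)) : Set (Matrix (Fin n) (Fin n) ℝ) :=
  logSet η P (G : Set (Matrix (Fin n) (Fin n) ℝ))

/-- `g² = exp⁻¹(G²) ∩ P 𝒦_{η,r,s}(ℝ) P⁻¹`, where `G² = {A² : A ∈ G}`. -/
def gSqSet {n r s : ℕ} (η : Shape n r s) (P : GL (Fin n) ℝ)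
    (G : Subsemigroup (Matrix (Fin n) (Fin n) ℝ)) : Set (Matrix (Fin n) (Fin n) ℝ) :=
  logSet η P ((fun A => A ^ 2) '' (G : Set (Matrix (Fin n) (Fin n) ℝ)))

/-- The additive semigroup `∑ₖ ℕ bₖ + ∑ₗ 2πℤ cₗ` of `ℝⁿ` (with `0 ∈ ℕ`). -/
def additiveSpan {n p s : ℕ} (b : Fin p → Fin n → ℝ) (c : Fin s → Fin n → ℝ) :
    AddSubmonoid (Fin n → ℝ) where
  carrier := {x | ∃ (a : Fin p → ℕ) (t : Fin s → ℤ),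
    x = ∑ k, (a k : ℝ) • b k + ∑ l, (2 * Real.pi * (t l : ℝ)) • c l}
  zero_mem' := ⟨0, 0, by simp⟩
  add_mem' := by
    rintro x y ⟨a, t, rfl⟩ ⟨a', t', rfl⟩
    refine ⟨a + a', t + t', ?_⟩
    simp only [Pi.add_apply, Nat.cast_add, Int.cast_add, mul_add, add_smul,
      Finset.sum_add_distrib]
    abel

end AbelianSemigroup

end

noncomputable section

namespace AbelianSemigroup

open Matrix

/-! The algebra P𝒦P⁻¹ is a sum of a copy of ℝ^r × ℂ^s, which commutes with the whole algebra, and an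
ideal of nilpotent matrices; modulo that ideal the first summand acts freely on v₀. `CellSystem`
keeps only these facts. They make logarithms rigid: what commutes with exp B commutes with B
(`CellSystem.commute_of_commute_exp`), and two logarithms of one matrix differ by a 2πi-period
(`exists_eq_of_exp_eq`).

Since exp B_k ∈ G, the A_k, the B_k and the imaginary units generate a commutative algebra, `hull`.
Squares of words in the A_k are the matrices exp(∑ a_k B_k), so the logarithms of squares are ∑ a_k
B_k plus periods, and evaluation at v₀ gives H. When I ∉ G only the terms with a = 0 may be missing;
they lie in a proper subspace, so density is unaffected (`dense_orbit_sqLogs`).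

If some G(v) is locally dense, then hull · v = ℝⁿ, and an invertible element of `hull` carries v to
v₀ and G(v) to G(v₀) (`locallyDense_base`). Once v₀ is cyclic, evaluation at v₀ identifies `hull`
with ℝⁿ, and exp becomes a continuous open map E of ℝⁿ whose fibres within H and meeting H are
controlled by periods. E maps H into G(v₀) ∪ {v₀}; conversely, squaring is locally onto near
invertible elements and sends G(v₀) into E(H). Hence G(v₀) is locally dense exactly when H is.

Finally, a locally dense H is dense (`dense_of_interior_closure_nonempty`): by Dickson's lemma, a
small ball is covered by finitely many translates of the largest subgroup of the closure of H. That
closed subgroup therefore has interior, and is everything. -/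

/-! ### Locally dense, finitely generated additive semigroups -/

/-- Dickson's lemma: the minimal elements form an antichain in a well-quasi-order. -/
theorem exists_finite_minimal_cover {ι : Type*} [Finite ι] (T : Set (ι → ℕ)) :
    ∃ F ⊆ T, F.Finite ∧ ∀ a ∈ T, ∃ m ∈ F, m ≤ a := by
  refine ⟨{m | Minimal (· ∈ T) m}, fun m hm => hm.1, ?_, fun a ha => ?_⟩
  · exact (setOfPred_minimal_antichain _).finite_of_partiallyWellOrderedOn
      (Set.isPWO_of_wellQuasiOrderedLE _)
  · obtain ⟨m, hm, hm'⟩ := (Set.isPWO_of_wellQuasiOrderedLE T).exists_le_minimal ha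
    exact ⟨m, hm', hm⟩

theorem exists_interior_nonempty_of_finite_biUnion {X ι : Type*} [TopologicalSpace X]
    {F : Set ι} (hF : F.Finite) {C : ι → Set X} (hC : ∀ i ∈ F, IsClosed (C i))
    (h : (interior (⋃ i ∈ F, C i)).Nonempty) : ∃ i ∈ F, (interior (C i)).Nonempty := by
  by_contra! hcon
  suffices interior (⋃ i ∈ F, C i) = ∅ by simp [this] at h
  clear h
  induction F, hF using Set.Finite.induction_on with
  | empty => simp
  | @insert a S ha hS ih =>
    rw [Set.biUnion_insert, interior_union_isClosed_of_interior_empty (hC a (by simp))]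
    · exact hcon a (by simp)
    · exact ih (fun i hi => hC i (by simp [hi])) (fun i hi => hcon i (by simp [hi]))

/-- A finitely generated additive semigroup (up to a subgroup that it contains) which is locally
dense is dense. -/
theorem dense_of_interior_closure_nonempty {V ι : Type*} [NormedAddCommGroup V] [NormedSpace ℝ V]
    [Fintype ι] (b : ι → V) (Λ : AddSubgroup V) (S : AddSubmonoid V)
    (hS : ∀ x, x ∈ S ↔ ∃ a : ι → ℕ, ∃ c ∈ Λ, x = ∑ i, a i • b i + c)
    (h : (interior (closure (S : Set V))).Nonempty) : Dense (S : Set V) := by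
  classical
  set C : AddSubmonoid V := S.topologicalClosure with hCdef
  have hCcl : IsClosed (C : Set V) := S.isClosed_topologicalClosure
  have hSC : S ≤ C := S.le_topologicalClosure
  have hΛS : ∀ c ∈ Λ, c ∈ S := fun c hc => (hS c).2 ⟨0, c, hc, by simp⟩
  have hbS : ∀ i, b i ∈ S := fun i => (hS _).2 ⟨Pi.single i 1, 0, Λ.zero_mem, by
    simp [Pi.single_apply, ite_smul]⟩
  -- The largest subgroup inside the closure C.
  let Γ : AddSubgroup V :=
    { carrier := {x | x ∈ C ∧ -x ∈ C}
      zero_mem' := by simp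
      add_mem' := fun {x y} hx hy => ⟨C.add_mem hx.1 hy.1, by
        rw [neg_add]; exact C.add_mem hx.2 hy.2⟩
      neg_mem' := fun {x} hx => ⟨hx.2, by simpa using hx.1⟩ }
  have hΓcl : IsClosed (Γ : Set V) := hCcl.inter (hCcl.preimage continuous_neg)
  have hsep : ∀ j, ∃ ε > 0, -b j ∉ C → ∀ x ∈ S, ε ≤ dist x (-b j) := by
    intro j
    by_cases hj : -b j ∈ C
    · exact ⟨1, one_pos, fun h => absurd hj h⟩
    · have : -b j ∉ closure (S : Set V) := hj
      rw [Metric.mem_closure_iff] at this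
      push Not at this
      obtain ⟨ε, h0, h1⟩ := this
      exact ⟨ε, h0, fun _ x hx => by rw [dist_comm]; exact h1 x hx⟩
  choose ε hε0 hε using hsep
  obtain ⟨y, hy⟩ := h
  obtain ⟨δ₀, hδ₀, hball⟩ := Metric.isOpen_iff.1 isOpen_interior y hy
  -- The diameter bound 2δ must not exceed the distance from S to any -b j outside C.
  obtain ⟨δ, hδ, hδle, hδε⟩ : ∃ δ > 0, δ ≤ δ₀ ∧ ∀ j, 2 * δ ≤ ε j := by
    obtain ⟨δ, hδ, h1⟩ : ∃ δ > 0, ∀ j, δ ≤ ε j := by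
      rcases isEmpty_or_nonempty ι with hι | hι
      · exact ⟨1, one_pos, fun j => hι.elim j⟩
      · obtain ⟨j, hj⟩ := Finite.exists_min ε
        exact ⟨ε j, hε0 j, hj⟩
    refine ⟨min δ₀ (δ / 2), by positivity, min_le_left _ _, fun j => ?_⟩
    linarith [h1 j, min_le_right δ₀ (δ / 2)]
  obtain ⟨F, hFT, hFfin, hF⟩ := exists_finite_minimal_cover
    {a : ι → ℕ | ∃ c ∈ Λ, ∑ i, a i • b i + c ∈ Metric.ball y δ}
  let D : (ι → ℕ) → Set V := fun m => (fun x => x - ∑ i, m i • b i) ⁻¹' (Γ : Set V)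
  have hDcl : ∀ m ∈ F, IsClosed (D m) := fun m _ => hΓcl.preimage (by fun_prop)
  have hcover : Metric.ball y δ ∩ S ⊆ ⋃ m ∈ F, D m := by
    rintro x ⟨hxb, hxS⟩
    obtain ⟨a, c, hc, rfl⟩ := (hS x).1 hxS
    obtain ⟨m, hmF, hma⟩ := hF a ⟨c, hc, hxb⟩
    obtain ⟨c', hc', hmb⟩ := hFT hmF
    refine Set.mem_iUnion₂.2 ⟨m, hmF, ?_⟩
    have key : ∑ i, a i • b i + c - ∑ i, m i • b i = ∑ i, (a i - m i) • b i + c := by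
      rw [add_sub_right_comm, ← Finset.sum_sub_distrib]
      congr 1
      refine Finset.sum_congr rfl fun i _ => ?_
      rw [sub_eq_iff_eq_add, ← add_smul, Nat.sub_add_cancel (hma i)]
    change ∑ i, a i • b i + c - ∑ i, m i • b i ∈ Γ
    rw [key]
    -- It remains to see that a and m differ only at indices j with -b j ∈ C, for which b j ∈ Γ.
    refine Γ.add_mem (Γ.sum_mem fun j _ => ?_)
      ⟨hSC (hΛS _ hc), hSC (hΛS _ (Λ.neg_mem hc))⟩
    by_cases hj : -b j ∈ C
    · exact Γ.nsmul_mem ⟨hSC (hbS j), hj⟩ _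
    · rcases (hma j).eq_or_lt with heq | hlt
      · rw [heq, Nat.sub_self, zero_smul]; exact Γ.zero_mem
      · replace hlt : m j < a j := hlt
        exfalso
        -- If a j > m j, removing one b j from the difference of the two points of the ball leaves
        -- an element of S within 2δ of -b j.
        have hmem : ∑ i, ((a i - m i) - (Pi.single j 1 : ι → ℕ) i) • b i + (c - c') ∈ S :=
          (hS _).2 ⟨fun i => (a i - m i) - (Pi.single j 1 : ι → ℕ) i, c - c',
            Λ.sub_mem hc hc', rfl⟩
        have h1 : ∑ i, ((a i - m i) - (Pi.single j 1 : ι → ℕ) i) • b i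
            = ∑ i, (a i - m i) • b i - b j := by
          rw [eq_sub_iff_add_eq]
          have : b j = ∑ i, (Pi.single j 1 : ι → ℕ) i • b i := by
            simp [Pi.single_apply, ite_smul]
          rw [this, ← Finset.sum_add_distrib]
          refine Finset.sum_congr rfl fun i _ => ?_
          rw [← add_smul, Nat.sub_add_cancel]
          rcases eq_or_ne i j with rfl | hij
          · rw [Pi.single_eq_same]; omega
          · simp [hij]
        have h2 := hε j hj _ hmem
        rw [h1, dist_eq_norm] at h2
        have h3 : ∑ i, (a i - m i) • b i - b j + (c - c') - -b j
            = (∑ i, a i • b i + c) - (∑ i, m i • b i + c') := by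
          linear_combination (norm := module) (-1 : ℤ) • key
        rw [h3, ← dist_eq_norm] at h2
        have h4 := dist_triangle_right (∑ i, a i • b i + c) (∑ i, m i • b i + c') y
        have h5 := Metric.mem_ball.1 hxb
        have h6 := Metric.mem_ball.1 hmb
        linarith [hδε j]
  have hsub : Metric.ball y δ ⊆ ⋃ m ∈ F, D m := by
    have hcl : IsClosed (⋃ m ∈ F, D m) := hFfin.isClosed_biUnion hDcl
    refine subset_trans (fun x hx => ?_) (closure_minimal hcover hcl)
    exact Metric.isOpen_ball.inter_closure
      ⟨hx, interior_subset (hball (Metric.ball_subset_ball hδle hx))⟩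
  -- One of finitely many closed translates has interior, so Γ is open as well as closed; V is
  -- connected.
  obtain ⟨m, -, z, hz⟩ := exists_interior_nonempty_of_finite_biUnion hFfin hDcl
    ⟨y, interior_maximal hsub Metric.isOpen_ball (Metric.mem_ball_self hδ)⟩
  have hΓnhds : (Γ : Set V) ∈ nhds (z - ∑ i, m i • b i) := by
    have h1 := mem_interior_iff_mem_nhds.1 hz
    have h2 := (Homeomorph.subRight (∑ i, m i • b i)).map_nhds_eq z
    change (Γ : Set V) ∈ nhds ((Homeomorph.subRight (∑ i, m i • b i)) z)
    rw [← h2]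
    exact h1
  have hΓopen : IsOpen (Γ : Set V) := Γ.isOpen_of_mem_nhds hΓnhds
  have huniv : (Γ : Set V) = Set.univ := IsClopen.eq_univ ⟨hΓcl, hΓopen⟩ ⟨0, Γ.zero_mem⟩
  intro x
  have hx : x ∈ (Γ : Set V) := huniv ▸ Set.mem_univ x
  exact hx.1

/-! ### Exponentials of nilpotent matrices -/

theorem map_exp_of_finiteDimensional {𝔸 𝔹 : Type*} [NormedRing 𝔸] [NormedAlgebra ℝ 𝔸]
    [FiniteDimensional ℝ 𝔸] [Ring 𝔹] [Algebra ℝ 𝔹] [TopologicalSpace 𝔹] [IsTopologicalRing 𝔹]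
    [ContinuousSMul ℝ 𝔹] [T2Space 𝔹] (f : 𝔸 →ₐ[ℝ] 𝔹) (x : 𝔸) :
    f (NormedSpace.exp x) = NormedSpace.exp (f x) := by
  have : CompleteSpace 𝔸 := FiniteDimensional.complete ℝ 𝔸
  have h := (NormedSpace.exp_series_hasSum_exp' (𝕂 := ℝ) x).map f
    (LinearMap.continuous_of_finiteDimensional f.toLinearMap)
  rw [← h.tsum_eq, NormedSpace.exp_eq_tsum ℝ]
  simp

theorem exp_eq_sum_of_pow_eq_zero {ι : Type*} [Fintype ι] [DecidableEq ι] {N : Matrix ι ι ℝ}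
    {m : ℕ} (h : N ^ m = 0) :
    NormedSpace.exp N = ∑ i ∈ Finset.range m, ((i.factorial : ℝ)⁻¹) • N ^ i := by
  rw [NormedSpace.exp_eq_tsum ℝ]
  refine tsum_eq_sum fun i hi => ?_
  rw [pow_eq_zero_of_le (by simpa using hi) h, smul_zero]

/-- L(exp(jN)) is a polynomial in j whose linear coefficient is L N; being constant on ℕ, it is a
constant polynomial. -/
theorem apply_eq_zero_of_apply_exp_pow {ι : Type*} [Fintype ι] [DecidableEq ι]
    {N : Matrix ι ι ℝ} (hN : IsNilpotent N) (L : Matrix ι ι ℝ →ₗ[ℝ] ℝ) (c : ℝ)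
    (h : ∀ j : ℕ, L (NormedSpace.exp N ^ j) = c) : L N = 0 := by
  obtain ⟨m, hm⟩ := hN
  -- The exponent is at least 2, so that the linear term occurs in the sum.
  have hm' : N ^ (m + 2) = 0 := pow_eq_zero_of_le (by omega) hm
  let q : Polynomial ℝ := ∑ i ∈ Finset.range (m + 2),
    Polynomial.monomial i ((i.factorial : ℝ)⁻¹ * L (N ^ i)) - Polynomial.C c
  have hq : ∀ j : ℕ, q.eval (j : ℝ) = 0 := by
    intro j
    have h1 : (j • N) ^ (m + 2) = 0 := by rw [smul_pow, hm', smul_zero]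
    have h2 := h j
    rw [← Matrix.exp_nsmul, exp_eq_sum_of_pow_eq_zero h1, map_sum] at h2
    simp only [q, Polynomial.eval_sub, Polynomial.eval_finsetSum, Polynomial.eval_monomial,
      Polynomial.eval_C]
    rw [← h2, sub_eq_zero]
    refine Finset.sum_congr rfl fun i _ => ?_
    rw [map_smul, smul_pow, map_nsmul, nsmul_eq_mul, smul_eq_mul]
    push_cast
    ring
  have hq0 : q = 0 := Polynomial.eq_zero_of_infinite_isRoot q <|
    (Set.infinite_range_of_injective (Nat.cast_injective (R := ℝ))).mono
      (by rintro _ ⟨j, rfl⟩; exact hq j)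
  have h1 := congrArg (fun q => Polynomial.coeff q 1) hq0
  simpa [q, Polynomial.coeff_monomial, Polynomial.coeff_C] using h1

theorem commute_of_commute_exp {ι : Type*} [Fintype ι] [DecidableEq ι] {N X : Matrix ι ι ℝ}
    (hN : IsNilpotent N) (h : Commute X (NormedSpace.exp N)) : Commute X N := by
  ext a b
  -- Applied to the entries of the commutator with X, which vanish on every power of exp N.
  have := apply_eq_zero_of_apply_exp_pow hN
    ((Matrix.entryLinearMap ℝ ℝ a b) ∘ₗ (LinearMap.mulLeft ℝ X - LinearMap.mulRight ℝ X)) 0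
    (fun j => by
      have := (h.pow_right j).eq
      simp [this])
  simpa [sub_eq_zero] using this

theorem eq_zero_of_exp_eq_one {ι : Type*} [Fintype ι] [DecidableEq ι] {N : Matrix ι ι ℝ}
    (hN : IsNilpotent N) (h : NormedSpace.exp N = 1) : N = 0 := by
  ext a b
  simpa using apply_eq_zero_of_apply_exp_pow hN (Matrix.entryLinearMap ℝ ℝ a b)
    ((1 : Matrix ι ι ℝ) a b) (fun j => by simp [h])

/-! ### The abstract algebra: logarithms, periods, units -/

/-- A subalgebra of `M_n(ℝ)` which is the sum of a copy of `ℝ^r × ℂ^s` and of a commuting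
nilpotent ideal, with a vector on which the former acts freely modulo the latter. -/
structure CellSystem (n r s : ℕ) where
  /-- the copy of `ℝ^r × ℂ^s` -/
  diag : ((Fin r → ℝ) × (Fin s → ℂ)) →ₐ[ℝ] Matrix (Fin n) (Fin n) ℝ
  /-- the nilpotent ideal -/
  nil : Submodule ℝ (Matrix (Fin n) (Fin n) ℝ)
  /-- the base vector -/
  base : Fin n → ℝ
  mul_mem_nil : ∀ M ∈ nil, ∀ N ∈ nil, M * N ∈ nil
  diag_mul_mem_nil : ∀ d, ∀ N ∈ nil, diag d * N ∈ nil
  diag_commute : ∀ d, ∀ N ∈ nil, Commute (diag d) N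
  isNilpotent : ∀ N ∈ nil, IsNilpotent N
  eq_zero_of_mulVec : ∀ d, ∀ N ∈ nil, ∀ w, diag d *ᵥ base = N *ᵥ w → d = 0

namespace CellSystem

variable {n r s : ℕ} (D : CellSystem n r s)

/-- The sum of the diagonal and of the nilpotent part. -/
def alg : Subalgebra ℝ (Matrix (Fin n) (Fin n) ℝ) where
  carrier := {X | ∃ d, ∃ N ∈ D.nil, X = D.diag d + N}
  mul_mem' := by
    rintro _ _ ⟨d, N, hN, rfl⟩ ⟨d', N', hN', rfl⟩
    refine ⟨d * d', D.diag d * N' + D.diag d' * N + N * N', ?_, ?_⟩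
    · exact D.nil.add_mem (D.nil.add_mem (D.diag_mul_mem_nil d _ hN')
        (D.diag_mul_mem_nil d' _ hN)) (D.mul_mem_nil _ hN _ hN')
    · rw [(D.diag_commute d' N hN).eq, map_mul]
      noncomm_ring
  add_mem' := by
    rintro _ _ ⟨d, N, hN, rfl⟩ ⟨d', N', hN', rfl⟩
    exact ⟨d + d', N + N', D.nil.add_mem hN hN', by rw [map_add]; abel⟩
  algebraMap_mem' := fun c => ⟨algebraMap ℝ _ c, 0, D.nil.zero_mem, by
    rw [add_zero, AlgHom.commutes]⟩

theorem diag_mem_alg (d) : D.diag d ∈ D.alg := ⟨d, 0, D.nil.zero_mem, (add_zero _).symm⟩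

theorem diag_commute_of_mem_alg (d) {X} (hX : X ∈ D.alg) : Commute (D.diag d) X := by
  obtain ⟨d', N, hN, rfl⟩ := hX
  refine Commute.add_right ?_ (D.diag_commute d N hN)
  exact (Commute.all d d').map D.diag

theorem exp_diag (d) : NormedSpace.exp (D.diag d) = D.diag (NormedSpace.exp d) := by
  exact (map_exp_of_finiteDimensional D.diag d).symm

theorem exp_sub_one_mem_nil {N} (hN : N ∈ D.nil) : NormedSpace.exp N - 1 ∈ D.nil := by
  obtain ⟨m, hm⟩ := D.isNilpotent N hN
  have hm' : N ^ (m + 1) = 0 := pow_eq_zero_of_le (by omega) hm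
  have hpow : ∀ i, N ^ (i + 1) ∈ D.nil := by
    intro i
    induction i with
    | zero => simpa using hN
    | succ i ih => rw [pow_succ]; exact D.mul_mem_nil _ ih _ hN
  rw [exp_eq_sum_of_pow_eq_zero hm', Finset.sum_range_succ']
  simpa using D.nil.sum_mem fun i _ => D.nil.smul_mem _ (hpow i)

/-- The diagonal part of B commutes with all of `alg`, so its exponential can be divided out,
leaving the nilpotent case. -/
theorem commute_of_commute_exp {X B} (hX : X ∈ D.alg) (hB : B ∈ D.alg)
    (h : Commute X (NormedSpace.exp B)) : Commute X B := by
  obtain ⟨d, N, hN, rfl⟩ := hB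
  have hXd : Commute X (D.diag d) := (D.diag_commute_of_mem_alg d hX).symm
  refine hXd.add_right (AbelianSemigroup.commute_of_commute_exp (D.isNilpotent N hN) ?_)
  have h1 : NormedSpace.exp N
      = NormedSpace.exp (-D.diag d) * NormedSpace.exp (D.diag d + N) := by
    rw [← Matrix.exp_add_of_commute, neg_add_cancel_left]
    exact ((Commute.refl _).add_right (D.diag_commute d N hN)).neg_left
  rw [h1]
  exact (hXd.neg_right.exp_right).mul_right h

/-- The imaginary unit of the `l`-th complex factor. -/
def imag (l : Fin s) : Matrix (Fin n) (Fin n) ℝ := D.diag (0, Pi.single l Complex.I)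

/-- The logarithms of the identity. -/
def period (t : Fin s → ℤ) : Matrix (Fin n) (Fin n) ℝ :=
  ∑ l, (2 * Real.pi * (t l : ℝ)) • D.imag l

theorem period_eq (t : Fin s → ℤ) :
    D.period t = D.diag (0, fun l => (t l : ℂ) * (2 * Real.pi * Complex.I)) := by
  simp only [period, imag, ← map_smul, ← map_sum]
  congr 1
  ext l
  · simp [Prod.fst_sum]
  · simp only [Prod.snd_sum, Prod.smul_snd, Finset.sum_apply, Pi.smul_apply, Pi.single_apply,
      Complex.real_smul]
    rw [Finset.sum_eq_single l (by intro b _ hb; simp [hb.symm]) (by simp)]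
    simp
    ring

theorem exp_period (t : Fin s → ℤ) : NormedSpace.exp (D.period t) = 1 := by
  rw [period_eq, exp_diag, ← map_one D.diag]
  congr 1
  ext l
  · rw [Prod.fst_exp]
    simp
  · rw [Prod.snd_exp, Pi.coe_exp, ← Complex.exp_eq_exp_ℂ]
    exact Complex.exp_int_mul_two_pi_mul_I _

theorem eq_period_of_exp_eq_one {X} (hX : X ∈ D.alg) (h : NormedSpace.exp X = 1) :
    ∃ t, X = D.period t := by
  obtain ⟨d, N, hN, rfl⟩ := hX
  rw [Matrix.exp_add_of_commute _ _ (D.diag_commute d N hN), exp_diag] at h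
  set N' := NormedSpace.exp N - 1 with hN'
  have hN'mem : N' ∈ D.nil := D.exp_sub_one_mem_nil hN
  have hd : NormedSpace.exp d - 1 = 0 := by
    -- From exp(d)(1 + N') = 1, the matrix of exp d - 1 equals -exp(d)N', which is in `nil`;
    -- freeness on the base vector then gives exp d = 1.
    refine D.eq_zero_of_mulVec _ (-(D.diag (NormedSpace.exp d) * N'))
      (D.nil.neg_mem (D.diag_mul_mem_nil _ _ hN'mem)) D.base ?_
    congr 1
    rw [map_sub, map_one, hN', mul_sub, h]
    noncomm_ring
  rw [sub_eq_zero] at hd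
  have hN0 : N = 0 := by
    refine eq_zero_of_exp_eq_one (D.isNilpotent N hN) ?_
    rwa [hd, map_one, one_mul] at h
  have h2 : ∀ l, ∃ t : ℤ, d.2 l = t * (2 * Real.pi * Complex.I) := by
    intro l
    rw [← Complex.exp_eq_one_iff, Complex.exp_eq_exp_ℂ]
    have := congrArg (fun e => e.2 l) hd
    simpa [Prod.snd_exp, Pi.coe_exp] using this
  choose t ht using h2
  refine ⟨t, ?_⟩
  rw [period_eq, hN0, add_zero]
  congr 1
  ext k
  · have := congrArg (fun e => e.1 k) hd
    simp only [Prod.fst_exp, Pi.coe_exp, ← Real.exp_eq_exp_ℝ, Prod.fst_one, Pi.one_apply,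
      Real.exp_eq_one_iff] at this
    simpa using this
  · simpa using ht k

/-- Write X = d + N. If e d = 0, then e · base = (e N) v, so e = 0 by freeness. Thus d is a
non-zero-divisor in an Artinian ring, hence a unit, and adding the commuting nilpotent N preserves
this. -/
theorem isUnit_of_mulVec_eq_base {X} (hX : X ∈ D.alg) {v} (h : X *ᵥ v = D.base) : IsUnit X := by
  obtain ⟨d, N, hN, rfl⟩ := hX
  have hd : d ∈ nonZeroDivisors ((Fin r → ℝ) × (Fin s → ℂ)) := by
    refine mem_nonZeroDivisors_iff_right.2 fun e he => ?_
    refine D.eq_zero_of_mulVec e _ (D.diag_mul_mem_nil e N hN) v ?_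
    rw [← h, Matrix.mulVec_mulVec, mul_add, ← map_mul, he, map_zero, zero_add]
  exact (D.isNilpotent N hN).isUnit_add_left_of_commute
    ((IsArtinianRing.isUnit_of_mem_nonZeroDivisors hd).map D.diag) (D.diag_commute d N hN).symm

theorem span_imag_ne_top (hn : 0 < n) :
    Submodule.span ℝ (Set.range fun l => D.imag l *ᵥ D.base) ≠ ⊤ := by
  intro h
  have h1 : D.base ∈ Submodule.span ℝ (Set.range fun l => D.imag l *ᵥ D.base) := by simp [h]
  obtain ⟨c, hc⟩ := (Submodule.mem_span_range_iff_exists_fun ℝ).1 h1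
  -- A combination of the imaginary units equal to 1 on the base vector would equal 1 in ℝ^r × ℂ^s,
  -- which the real parts forbid.
  have h2 : (1 - ∑ l, c l • ((0 : Fin r → ℝ), (Pi.single l Complex.I : Fin s → ℂ))) = 0 := by
    refine D.eq_zero_of_mulVec _ 0 D.nil.zero_mem 0 ?_
    simp only [map_sub, map_one, map_sum, map_smul, Matrix.sub_mulVec, Matrix.one_mulVec,
      Matrix.sum_mulVec, Matrix.smul_mulVec, Matrix.zero_mulVec]
    rw [sub_eq_zero]
    exact hc.symm
  have h3 : (1 : (Fin r → ℝ) × (Fin s → ℂ)) = 0 := by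
    ext l
    · have := congrArg (fun e => e.1 l) h2
      simp [Prod.fst_sum] at this
    · exfalso
      have := congrArg (fun e => (e.2 l).re) h2
      have h4 : ∀ x, c x * ((Pi.single x Complex.I : Fin s → ℂ) l).re = 0 := by
        intro x
        rcases eq_or_ne l x with rfl | hx
        · simp
        · simp [hx]
      simp [Prod.snd_sum, h4] at this
  have h4 : (1 : Matrix (Fin n) (Fin n) ℝ) = 0 := by
    rw [← map_one D.diag, h3, map_zero]
  have := congrFun (congrFun h4 ⟨0, hn⟩) ⟨0, hn⟩
  simp at this

end CellSystem

/-! ### Semigroups generated by square roots of exponentials -/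

namespace CellSystem

variable {n r s : ℕ}

/-- The two meanings of "generates" differ at most by the identity, so words can be handled in the
generated monoid. -/
theorem _root_.Subsemigroup.mem_monoidClosure_iff {M : Type*} [Monoid M] {S : Set M}
    {G : Subsemigroup M} (hG : Subsemigroup.closure S = G ∨
      (Submonoid.closure S).toSubsemigroup = G) {X : M} :
    X ∈ Submonoid.closure S ↔ X ∈ G ∨ X = 1 := by
  have hle : S ⊆ G := by
    rcases hG with rfl | rfl
    · exact Subsemigroup.subset_closure
    · exact Submonoid.subset_closure
  have hle' : ∀ Y ∈ G, Y ∈ Submonoid.closure S := by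
    rcases hG with rfl | rfl
    · exact fun Y hY => (Subsemigroup.closure_le (S := (Submonoid.closure S).toSubsemigroup)).2
        Submonoid.subset_closure hY
    · exact fun Y hY => hY
  constructor
  · intro hX
    induction hX using Submonoid.closure_induction with
    | mem x hx => exact Or.inl (hle hx)
    | one => exact Or.inr rfl
    | mul x y _ _ hx hy =>
      rcases hx with hx | rfl
      · rcases hy with hy | rfl
        · exact Or.inl (G.mul_mem hx hy)
        · rw [mul_one]; exact Or.inl hx
      · rwa [one_mul]
  · rintro (hX | rfl)
    · exact hle' X hX
    · exact Submonoid.one_mem _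

/-- An abelian semigroup `G` inside `D.alg`, generated by matrices whose squares have logarithms
`B k` in `D.alg` with `exp (B k) ∈ G`. -/
structure LogGenerated (D : CellSystem n r s) (p : ℕ) where
  /-- the semigroup -/
  G : Subsemigroup (Matrix (Fin n) (Fin n) ℝ)
  /-- the generators -/
  A : Fin p → Matrix (Fin n) (Fin n) ℝ
  /-- the logarithms of the squares of the generators -/
  B : Fin p → Matrix (Fin n) (Fin n) ℝ
  comm : ∀ X ∈ G, ∀ Y ∈ G, X * Y = Y * X
  mem_alg : ∀ X ∈ G, X ∈ D.alg
  gen : Subsemigroup.closure (Set.range A) = G ∨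
    (Submonoid.closure (Set.range A)).toSubsemigroup = G
  exp_B_mem : ∀ k, NormedSpace.exp (B k) ∈ G
  B_mem_alg : ∀ k, B k ∈ D.alg
  sq_eq_exp : ∀ k, A k ^ 2 = NormedSpace.exp (B k)

namespace LogGenerated

variable {D : CellSystem n r s} {p : ℕ} (S : D.LogGenerated p)

theorem A_mem (k) : S.A k ∈ S.G := by
  have h := S.gen
  rcases h with h | h <;> rw [← h]
  · exact Subsemigroup.subset_closure ⟨k, rfl⟩
  · exact Submonoid.subset_closure ⟨k, rfl⟩

theorem commute_B_of_mem {X} (hX : X ∈ S.G) (k) : Commute X (S.B k) :=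
  D.commute_of_commute_exp (S.mem_alg X hX) (S.B_mem_alg k) (S.comm _ hX _ (S.exp_B_mem k))

theorem commute_B_B (j k) : Commute (S.B j) (S.B k) :=
  D.commute_of_commute_exp (S.B_mem_alg j) (S.B_mem_alg k)
    (S.commute_B_of_mem (S.exp_B_mem k) j).symm

/-- The algebra generated by the generators, their logarithms and the imaginary units. -/
def hull : Subalgebra ℝ (Matrix (Fin n) (Fin n) ℝ) :=
  Algebra.adjoin ℝ (Set.range S.A ∪ Set.range S.B ∪ Set.range D.imag)

theorem A_mem_hull (k) : S.A k ∈ S.hull := Algebra.subset_adjoin (.inl (.inl ⟨k, rfl⟩))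

theorem B_mem_hull (k) : S.B k ∈ S.hull := Algebra.subset_adjoin (.inl (.inr ⟨k, rfl⟩))

theorem imag_mem_hull (l) : D.imag l ∈ S.hull := Algebra.subset_adjoin (.inr ⟨l, rfl⟩)

theorem hull_le : S.hull ≤ D.alg := by
  refine Algebra.adjoin_le ?_
  rintro _ ((⟨k, rfl⟩ | ⟨k, rfl⟩) | ⟨l, rfl⟩)
  · exact S.mem_alg _ (S.A_mem k)
  · exact S.B_mem_alg k
  · exact D.diag_mem_alg _

/-- The ambient algebra need not be commutative; it suffices to check the nine pairs of kinds of
generators. -/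
theorem commute_of_mem_hull {X Y} (hX : X ∈ S.hull) (hY : Y ∈ S.hull) : Commute X Y := by
  refine Algebra.commute_of_mem_adjoin_of_forall_mem_commute hY fun y hy => ?_
  refine (Algebra.commute_of_mem_adjoin_of_forall_mem_commute hX fun x hx => ?_).symm
  have hi : ∀ l, ∀ z ∈ D.alg, Commute (D.imag l) z := fun l z hz =>
    D.diag_commute_of_mem_alg _ hz
  have hA := fun k => S.mem_alg _ (S.A_mem k)
  rcases hx with (⟨j, rfl⟩ | ⟨j, rfl⟩) | ⟨j, rfl⟩ <;>
    rcases hy with (⟨k, rfl⟩ | ⟨k, rfl⟩) | ⟨k, rfl⟩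
  · exact S.comm _ (S.A_mem k) _ (S.A_mem j)
  · exact (S.commute_B_of_mem (S.A_mem j) k).symm
  · exact hi k _ (hA j)
  · exact S.commute_B_of_mem (S.A_mem k) j
  · exact S.commute_B_B k j
  · exact hi k _ (S.B_mem_alg j)
  · exact (hi j _ (hA k)).symm
  · exact (hi j _ (S.B_mem_alg k)).symm
  · exact hi k _ (D.diag_mem_alg _)

theorem mem_closure_iff {X} : X ∈ Submonoid.closure (Set.range S.A) ↔ X ∈ S.G ∨ X = 1 :=
  Subsemigroup.mem_monoidClosure_iff S.gen

theorem mem_hull_of_mem_closure {X} (hX : X ∈ Submonoid.closure (Set.range S.A)) :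
    X ∈ S.hull :=
  (Submonoid.closure_le (S := S.hull.toSubmonoid)).2
    (by rintro _ ⟨k, rfl⟩; exact S.A_mem_hull k) hX

theorem mem_hull {X} (hX : X ∈ S.G) : X ∈ S.hull :=
  S.mem_hull_of_mem_closure (S.mem_closure_iff.2 (.inl hX))

/-- The nonnegative integer combinations of the logarithms. -/
def logs (a : Fin p → ℕ) : Matrix (Fin n) (Fin n) ℝ := ∑ k, a k • S.B k

theorem logs_add (a b) : S.logs (a + b) = S.logs a + S.logs b := by
  simp [logs, add_smul, Finset.sum_add_distrib]

theorem logs_single (k) : S.logs (Pi.single k 1) = S.B k := by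
  simp [logs, Pi.single_apply, ite_smul]

theorem logs_mem_hull (a) : S.logs a ∈ S.hull :=
  S.hull.sum_mem fun k _ => S.hull.nsmul_mem (S.B_mem_hull k) _

theorem period_mem_hull (t) : D.period t ∈ S.hull :=
  S.hull.sum_mem fun k _ => S.hull.smul_mem (S.imag_mem_hull k) _

theorem exp_add {X Y} (hX : X ∈ S.hull) (hY : Y ∈ S.hull) :
    NormedSpace.exp (X + Y) = NormedSpace.exp X * NormedSpace.exp Y :=
  Matrix.exp_add_of_commute _ _ (S.commute_of_mem_hull hX hY)

theorem exp_logs_add_period (a t) :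
    NormedSpace.exp (S.logs a + D.period t) = NormedSpace.exp (S.logs a) := by
  rw [S.exp_add (S.logs_mem_hull a) (S.period_mem_hull t), D.exp_period, mul_one]

theorem exists_sq_eq_exp_logs {X} (hX : X ∈ Submonoid.closure (Set.range S.A)) :
    ∃ a, X ^ 2 = NormedSpace.exp (S.logs a) := by
  induction hX using Submonoid.closure_induction with
  | mem x hx =>
    obtain ⟨k, rfl⟩ := hx
    exact ⟨Pi.single k 1, by rw [logs_single, S.sq_eq_exp]⟩
  | one => exact ⟨0, by simp [logs]⟩
  | mul x y hx hy ihx ihy =>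
    obtain ⟨a, ha⟩ := ihx
    obtain ⟨b, hb⟩ := ihy
    refine ⟨a + b, ?_⟩
    rw [logs_add, S.exp_add (S.logs_mem_hull a) (S.logs_mem_hull b), ← ha, ← hb,
      (S.commute_of_mem_hull (S.mem_hull_of_mem_closure hx)
        (S.mem_hull_of_mem_closure hy)).mul_pow]

theorem exists_exp_logs_eq_sq (a : Fin p → ℕ) :
    ∃ X ∈ Submonoid.closure (Set.range S.A), X ^ 2 = NormedSpace.exp (S.logs a) := by
  suffices ∀ t : Finset (Fin p), ∃ X ∈ Submonoid.closure (Set.range S.A),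
      X ^ 2 = NormedSpace.exp (∑ k ∈ t, a k • S.B k) from this Finset.univ
  intro t
  induction t using Finset.induction_on with
  | empty => exact ⟨1, Submonoid.one_mem _, by simp⟩
  | insert k t hk ih =>
    obtain ⟨X, hX, hX2⟩ := ih
    have hA : S.A k ∈ Submonoid.closure (Set.range S.A) := Submonoid.subset_closure ⟨k, rfl⟩
    refine ⟨S.A k ^ a k * X, mul_mem (pow_mem hA _) hX, ?_⟩
    rw [Finset.sum_insert hk, S.exp_add (S.hull.nsmul_mem (S.B_mem_hull k) _)
      (S.hull.sum_mem fun k _ => S.hull.nsmul_mem (S.B_mem_hull k) _),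
      (S.commute_of_mem_hull (S.hull.pow_mem (S.A_mem_hull k) _)
        (S.mem_hull_of_mem_closure hX)).mul_pow, hX2, Matrix.exp_nsmul, ← S.sq_eq_exp, ← pow_mul,
      ← pow_mul, mul_comm 2]

theorem exists_exp_logs_eq_sq_of_ne_zero {a : Fin p → ℕ} (ha : a ≠ 0 ∨ 1 ∈ S.G) :
    ∃ X ∈ S.G, X ^ 2 = NormedSpace.exp (S.logs a) := by
  rcases ha with ha | h1
  · obtain ⟨k, hk⟩ := Function.ne_iff.1 ha
    -- One generator is set aside, so the word stays in G even when the remaining word is the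
    -- identity.
    obtain ⟨X, hX, hX2⟩ := S.exists_exp_logs_eq_sq (a - Pi.single k 1)
    have h : a = Pi.single k 1 + (a - Pi.single k 1) := by
      refine (add_tsub_cancel_of_le fun j => ?_).symm
      rcases eq_or_ne j k with rfl | hj
      · simpa [Nat.one_le_iff_ne_zero] using hk
      · simp [hj]
    refine ⟨S.A k * X, ?_, ?_⟩
    · rcases S.mem_closure_iff.1 hX with hX | rfl
      · exact S.G.mul_mem (S.A_mem k) hX
      · rw [mul_one]; exact S.A_mem k
    · rw [h, logs_add, logs_single, S.exp_add (S.B_mem_hull k) (S.logs_mem_hull _), ← hX2,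
        ← S.sq_eq_exp, (S.commute_of_mem_hull (S.A_mem_hull k)
        (S.mem_hull_of_mem_closure hX)).mul_pow]
  · obtain ⟨X, hX, hX2⟩ := S.exists_exp_logs_eq_sq a
    refine ⟨X, ?_, hX2⟩
    rcases S.mem_closure_iff.1 hX with hX | rfl
    exacts [hX, h1]

/-- The logarithms of the squares. -/
def sqLogs : Set (Matrix (Fin n) (Fin n) ℝ) :=
  {X | X ∈ D.alg ∧ ∃ Y ∈ S.G, Y ^ 2 = NormedSpace.exp X}

theorem logs_add_period_mem {a : Fin p → ℕ} (ha : a ≠ 0 ∨ 1 ∈ S.G) (t) :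
    S.logs a + D.period t ∈ S.sqLogs :=
  ⟨S.hull_le (S.hull.add_mem (S.logs_mem_hull a) (S.period_mem_hull t)), by
    rw [exp_logs_add_period]; exact S.exists_exp_logs_eq_sq_of_ne_zero ha⟩

/-- X commutes with exp X = exp Y, hence with Y, so exp(X - Y) = 1. -/
theorem exists_eq_of_exp_eq {X Y} (hX : X ∈ D.alg) (hY : Y ∈ D.alg)
    (h : NormedSpace.exp X = NormedSpace.exp Y) : ∃ t, X = Y + D.period t := by
  have hc : Commute X Y := D.commute_of_commute_exp hX hY
    (h ▸ (Commute.refl X).exp_right)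
  obtain ⟨t, ht⟩ := D.eq_period_of_exp_eq_one (D.alg.sub_mem hX hY) (by
    rw [sub_eq_add_neg, Matrix.exp_add_of_commute _ _ hc.neg_right, h,
      ← Matrix.exp_add_of_commute _ _ (Commute.refl Y).neg_right, add_neg_cancel,
      NormedSpace.exp_zero])
  exact ⟨t, by rw [← ht]; abel⟩

theorem exists_of_mem_sqLogs {X} (hX : X ∈ S.sqLogs) :
    ∃ a t, X = S.logs a + D.period t := by
  obtain ⟨hXa, Y, hY, hY2⟩ := hX
  obtain ⟨a, ha⟩ := S.exists_sq_eq_exp_logs (S.mem_closure_iff.2 (.inl hY))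
  exact ⟨a, exists_eq_of_exp_eq hXa (S.hull_le (S.logs_mem_hull a)) (hY2.symm.trans ha)⟩

theorem add_mem_sqLogs {X Y} (hX : X ∈ S.sqLogs) (hY : Y ∈ S.sqLogs) : X + Y ∈ S.sqLogs := by
  have hmem : ∀ Z ∈ S.sqLogs, Z ∈ S.hull := by
    intro Z hZ
    obtain ⟨a, t, rfl⟩ := S.exists_of_mem_sqLogs hZ
    exact S.hull.add_mem (S.logs_mem_hull a) (S.period_mem_hull t)
  refine ⟨D.alg.add_mem hX.1 hY.1, ?_⟩
  rw [S.exp_add (hmem X hX) (hmem Y hY)]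
  obtain ⟨-, U, hU, hU2⟩ := hX
  obtain ⟨-, V, hV, hV2⟩ := hY
  exact ⟨U * V, S.G.mul_mem hU hV, by
    rw [(show Commute U V from S.comm U hU V hV).mul_pow, hU2, hV2]⟩

/-- The additive semigroup spanned by the logarithms and the periods, applied to the base
vector. -/
def span : AddSubmonoid (Fin n → ℝ) :=
  additiveSpan (fun k => S.B k *ᵥ D.base) (fun l => D.imag l *ᵥ D.base)

theorem mem_span_iff {x} : x ∈ S.span ↔ ∃ a t, x = (S.logs a + D.period t) *ᵥ D.base := by
  have key : ∀ a t, (S.logs a + D.period t) *ᵥ D.base = ∑ k, (a k : ℝ) • S.B k *ᵥ D.base +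
      ∑ l, (2 * Real.pi * (t l : ℝ)) • D.imag l *ᵥ D.base := by
    intro a t
    simp only [logs, period, Matrix.add_mulVec, Matrix.sum_mulVec, Matrix.smul_mulVec,
      ← Nat.cast_smul_eq_nsmul ℝ]
  simp only [key]
  exact Iff.rfl

theorem orbit_sqLogs_subset : orbit S.sqLogs D.base ⊆ S.span := by
  rintro _ ⟨X, hX, rfl⟩
  obtain ⟨a, t, rfl⟩ := S.exists_of_mem_sqLogs hX
  exact S.mem_span_iff.2 ⟨a, t, rfl⟩

theorem orbit_sqLogs_eq (h : 1 ∈ S.G) : orbit S.sqLogs D.base = S.span := by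
  refine S.orbit_sqLogs_subset.antisymm fun x hx => ?_
  obtain ⟨a, t, rfl⟩ := S.mem_span_iff.1 hx
  exact ⟨_, S.logs_add_period_mem (.inr h) t, rfl⟩

/-- Only combinations with a = 0 may be missing from the orbit. They lie in W, a closed proper
subspace, whose dense complement is contained in the closure of the orbit. -/
theorem dense_orbit_sqLogs (hn : 0 < n) (h : Dense (S.span : Set (Fin n → ℝ))) :
    Dense (orbit S.sqLogs D.base) := by
  set W := Submodule.span ℝ (Set.range fun l => D.imag l *ᵥ D.base)
  have hsub : (S.span : Set (Fin n → ℝ)) ⊆ closure (orbit S.sqLogs D.base) ∪ W := by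
    intro x hx
    obtain ⟨a, t, rfl⟩ := S.mem_span_iff.1 hx
    rcases eq_or_ne a 0 with rfl | ha
    · right
      simp only [logs, period, Pi.zero_apply, zero_smul, Finset.sum_const_zero, zero_add,
        Matrix.sum_mulVec, Matrix.smul_mulVec]
      exact W.sum_mem fun l _ => W.smul_mem _ (Submodule.subset_span ⟨l, rfl⟩)
    · left
      exact subset_closure ⟨_, S.logs_add_period_mem (.inl ha) t, rfl⟩
  have huniv := closure_minimal hsub (isClosed_closure.union W.closed_of_finiteDimensional)
  rw [h.closure_eq] at huniv
  have hWint : interior (W : Set (Fin n → ℝ)) = ∅ := by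
    by_contra hne
    exact D.span_imag_ne_top hn
      (W.eq_top_of_nonempty_interior' (Set.nonempty_iff_ne_empty.2 hne))
  have hWd : Dense (W : Set (Fin n → ℝ))ᶜ := interior_eq_empty_iff_dense_compl.1 hWint
  refine dense_closure.1 (hWd.mono fun x hx => ?_)
  exact (huniv (Set.mem_univ x)).resolve_right hx

end LogGenerated
end CellSystem

/-! ### Matrix actions and locally dense sets -/

/-- Square matrices as continuous endomorphisms of `ℝⁿ`. -/
def toEndomorphism (n : ℕ) :
    Matrix (Fin n) (Fin n) ℝ ≃ₐ[ℝ] ((Fin n → ℝ) →L[ℝ] (Fin n → ℝ)) :=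
  Matrix.toLinAlgEquiv'.trans (Module.End.toContinuousLinearMap (Fin n → ℝ))

theorem toEndomorphism_apply {n : ℕ} (X : Matrix (Fin n) (Fin n) ℝ) (v : Fin n → ℝ) :
    toEndomorphism n X v = X *ᵥ v := rfl

/-- Moves exp to a normed algebra, where its analyticity and derivative can be used. -/
theorem exp_mulVec {n : ℕ} (X : Matrix (Fin n) (Fin n) ℝ) (v : Fin n → ℝ) :
    NormedSpace.exp X *ᵥ v = NormedSpace.exp (toEndomorphism n X) v := by
  have h := map_exp_of_finiteDimensional (toEndomorphism n).symm.toAlgHom (toEndomorphism n X)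
  have h' : (toEndomorphism n).symm (NormedSpace.exp (toEndomorphism n X)) =
      NormedSpace.exp ((toEndomorphism n).symm (toEndomorphism n X)) := h
  rw [AlgEquiv.symm_apply_apply] at h'
  rw [← h', ← toEndomorphism_apply, AlgEquiv.apply_symm_apply]

theorem isOpenMap_mulVec {n : ℕ} {X : Matrix (Fin n) (Fin n) ℝ} (hX : IsUnit X) :
    IsOpenMap (X *ᵥ ·) := by
  refine LinearMap.isOpenMap_of_finiteDimensional (Matrix.mulVecLin X) fun v => ?_
  obtain ⟨Y, hY⟩ := hX.exists_right_inv
  exact ⟨Y *ᵥ v, by simp [hY]⟩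

theorem continuous_mulVec {n : ℕ} (X : Matrix (Fin n) (Fin n) ℝ) : Continuous (X *ᵥ ·) :=
  (toEndomorphism n X).continuous

theorem LocallyDense.image {n : ℕ} {E : Set (Fin n → ℝ)} (hE : LocallyDense E)
    {f : (Fin n → ℝ) → Fin n → ℝ} (hc : Continuous f) (ho : IsOpenMap f) :
    LocallyDense (f '' E) :=
  Set.Nonempty.mono (interior_maximal
    ((Set.image_mono interior_subset).trans (image_closure_subset_closure_image hc))
    (ho _ isOpen_interior)) (Set.Nonempty.image f hE)

theorem LocallyDense.mono {n : ℕ} {E F : Set (Fin n → ℝ)} (hE : LocallyDense E) (h : E ⊆ F) :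
    LocallyDense F :=
  Set.Nonempty.mono (interior_mono (closure_mono h)) hE

/-- For n > 0 points are not open, so an open set inside the closure survives the removal of v. -/
theorem LocallyDense.of_insert {n : ℕ} (hn : 0 < n) {E : Set (Fin n → ℝ)} {v : Fin n → ℝ}
    (hE : LocallyDense (insert v E)) : LocallyDense E := by
  have : Nonempty (Fin n) := ⟨⟨0, hn⟩⟩
  obtain ⟨x, hx⟩ := hE
  have h1 : (interior (closure (insert v E)) ∩ {v}ᶜ).Nonempty :=
    (dense_compl_singleton v).inter_open_nonempty _ isOpen_interior ⟨x, hx⟩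
  refine h1.mono (interior_maximal ?_ (isOpen_interior.inter isOpen_compl_singleton))
  rintro y ⟨hy, hyv⟩
  have h2 := interior_subset hy
  rw [Set.insert_eq, closure_union, closure_singleton] at h2
  exact h2.resolve_left hyv

theorem span_eq_top_of_locallyDense {n : ℕ} {W : Submodule ℝ (Fin n → ℝ)}
    {E : Set (Fin n → ℝ)} (hE : LocallyDense E) (h : E ⊆ W) : W = ⊤ :=
  W.eq_top_of_nonempty_interior' <|
    Set.Nonempty.mono (interior_mono (closure_minimal h W.closed_of_finiteDimensional)) hE

/-! ### Orbits and the exponential chart at a cyclic vector -/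

namespace CellSystem

variable {n r s : ℕ} {D : CellSystem n r s}

theorem period_add (t u) : D.period (t + u) = D.period t + D.period u := by
  simp [period, mul_add, add_smul, Finset.sum_add_distrib]

namespace LogGenerated

variable {p : ℕ} (S : D.LogGenerated p)

theorem dense_span_of_locallyDense (h : LocallyDense (S.span : Set (Fin n → ℝ))) :
    Dense (S.span : Set (Fin n → ℝ)) := by
  let f : (Fin s → ℤ) →+ (Fin n → ℝ) :=
    AddMonoidHom.mk' (fun t => D.period t *ᵥ D.base) fun t u => by
      rw [period_add, Matrix.add_mulVec]
  refine dense_of_interior_closure_nonempty (fun k => S.B k *ᵥ D.base) f.range S.span ?_ h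
  intro x
  rw [mem_span_iff]
  refine exists_congr fun a => ⟨?_, ?_⟩
  · rintro ⟨t, rfl⟩
    exact ⟨_, ⟨t, rfl⟩, by
      simp only [logs, f, Matrix.add_mulVec, Matrix.sum_mulVec, Matrix.smul_mulVec,
        AddMonoidHom.mk'_apply]⟩
  · rintro ⟨_, ⟨t, rfl⟩, rfl⟩
    exact ⟨t, by
      simp only [logs, f, Matrix.add_mulVec, Matrix.sum_mulVec, Matrix.smul_mulVec,
        AddMonoidHom.mk'_apply]⟩

/-- The subspace `{X v : X ∈ hull}`. -/
def hullOrbit (v : Fin n → ℝ) : Submodule ℝ (Fin n → ℝ) :=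
  (Subalgebra.toSubmodule S.hull).map ((Matrix.mulVecBilin ℝ ℝ).flip v)

theorem mem_hullOrbit {v x} : x ∈ S.hullOrbit v ↔ ∃ X ∈ S.hull, X *ᵥ v = x := Iff.rfl

theorem orbit_subset_hullOrbit (v) :
    orbit (S.G : Set (Matrix (Fin n) (Fin n) ℝ)) v ⊆ S.hullOrbit v := by
  rintro _ ⟨X, hX, rfl⟩
  exact ⟨X, S.mem_hull hX, rfl⟩

theorem locallyDense_base {v}
    (h : LocallyDense (orbit (S.G : Set (Matrix (Fin n) (Fin n) ℝ)) v)) :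
    LocallyDense (orbit (S.G : Set (Matrix (Fin n) (Fin n) ℝ)) D.base) := by
  have htop := span_eq_top_of_locallyDense h (S.orbit_subset_hullOrbit v)
  -- The orbit of v under `hull` is a subspace with interior, so it contains the base vector; X
  -- commutes with G and carries G(v) to G(base).
  obtain ⟨X, hX, hXv⟩ := S.mem_hullOrbit.1 (htop ▸ Submodule.mem_top : D.base ∈ S.hullOrbit v)
  have hXu := D.isUnit_of_mulVec_eq_base (S.hull_le hX) hXv
  refine (h.image (continuous_mulVec X) (isOpenMap_mulVec hXu)).mono ?_
  rintro _ ⟨_, ⟨Y, hY, rfl⟩, rfl⟩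
  refine ⟨Y, hY, ?_⟩
  change Y *ᵥ D.base = X *ᵥ Y *ᵥ v
  rw [← hXv, Matrix.mulVec_mulVec, Matrix.mulVec_mulVec,
    (S.commute_of_mem_hull hX (S.mem_hull hY)).eq]

theorem exp_mem_hull {X} (hX : X ∈ S.hull) : NormedSpace.exp X ∈ S.hull := by
  have : IsClosed ((Subalgebra.toSubmodule S.hull : Submodule ℝ (Matrix (Fin n) (Fin n) ℝ)) :
    Set (Matrix (Fin n) (Fin n) ℝ)) := Submodule.closed_of_finiteDimensional _
  exact NormedSpace.exp_mem (R := ℝ) (s := S.hull) this hX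

theorem isUnit_of_mem {X} (hX : X ∈ S.G) : IsUnit X := by
  obtain ⟨a, ha⟩ := S.exists_sq_eq_exp_logs (S.mem_closure_iff.2 (.inl hX))
  exact (isUnit_pow_iff two_ne_zero).1 (ha ▸ Matrix.isUnit_exp _)

section Cyclic

variable (hc : S.hullOrbit D.base = ⊤)
include hc

/-- In a commutative algebra, agreement at a cyclic vector propagates to all vectors. -/
theorem eq_of_mulVec_base_eq {X Y} (hX : X ∈ S.hull) (hY : Y ∈ S.hull)
    (h : X *ᵥ D.base = Y *ᵥ D.base) : X = Y := by
  refine Matrix.mulVec_injective (funext fun x => ?_)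
  obtain ⟨Z, hZ, rfl⟩ := S.mem_hullOrbit.1 (hc ▸ Submodule.mem_top : x ∈ S.hullOrbit D.base)
  rw [Matrix.mulVec_mulVec, Matrix.mulVec_mulVec, (S.commute_of_mem_hull hX hZ).eq,
    (S.commute_of_mem_hull hY hZ).eq, ← Matrix.mulVec_mulVec, h, Matrix.mulVec_mulVec]

/-- If the base vector is cyclic, evaluation at the base vector has a linear inverse. -/
theorem exists_section : ∃ ψ : (Fin n → ℝ) →ₗ[ℝ] Matrix (Fin n) (Fin n) ℝ,
    (∀ x, ψ x ∈ S.hull) ∧ ∀ x, ψ x *ᵥ D.base = x := by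
  let ev : S.hull →ₗ[ℝ] (Fin n → ℝ) :=
    ((Matrix.mulVecBilin ℝ ℝ).flip D.base) ∘ₗ S.hull.val.toLinearMap
  have hev : Function.Bijective ev := by
    refine ⟨fun X Y h => Subtype.ext (S.eq_of_mulVec_base_eq hc X.2 Y.2 h), fun x => ?_⟩
    obtain ⟨Z, hZ, h⟩ := S.mem_hullOrbit.1 (hc ▸ Submodule.mem_top : x ∈ S.hullOrbit D.base)
    exact ⟨⟨Z, hZ⟩, h⟩
  let e := LinearEquiv.ofBijective ev hev
  exact ⟨S.hull.val.toLinearMap ∘ₗ e.symm.toLinearMap, fun x => (e.symm x).2,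
    fun x => e.apply_symm_apply x⟩

end Cyclic

variable {ψ : (Fin n → ℝ) →ₗ[ℝ] Matrix (Fin n) (Fin n) ℝ}

theorem continuous_exp_mulVec (v : Fin n → ℝ) :
    Continuous fun x => NormedSpace.exp (ψ x) *ᵥ v := by
  simp only [exp_mulVec]
  have h1 : Continuous fun x => toEndomorphism n (ψ x) :=
    LinearMap.continuous_of_finiteDimensional ((toEndomorphism n).toLinearMap ∘ₗ ψ)
  have h2 : Continuous (NormedSpace.exp : ((Fin n → ℝ) →L[ℝ] (Fin n → ℝ)) → _) :=
    continuous_iff_continuousAt.2 fun T => (NormedSpace.exp_analytic (𝕂 := ℝ) T).continuousAt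
  exact (h2.comp h1).clm_apply continuous_const

/-- The derivative at 0 is the identity, giving openness there; the law E(x + y) = exp(ψ x) E(y)
transports it to every point by an invertible matrix. -/
theorem isOpenMap_exp_mulVec (hψ : ∀ x, ψ x ∈ S.hull) (hψ' : ∀ x, ψ x *ᵥ D.base = x) :
    IsOpenMap fun x => NormedSpace.exp (ψ x) *ᵥ D.base := by
  let φ : (Fin n → ℝ) →L[ℝ] ((Fin n → ℝ) →L[ℝ] (Fin n → ℝ)) :=
    LinearMap.toContinuousLinearMap ((toEndomorphism n).toLinearMap ∘ₗ ψ)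
  set E := fun x => NormedSpace.exp (ψ x) *ᵥ D.base with hE
  have hEφ : E = fun x => NormedSpace.exp (φ x) D.base := funext fun x => exp_mulVec _ _
  have h0 : HasStrictFDerivAt E (ContinuousLinearMap.id ℝ (Fin n → ℝ)) 0 := by
    have h1 : HasStrictFDerivAt (fun x => NormedSpace.exp (φ x))
        ((1 : ((Fin n → ℝ) →L[ℝ] (Fin n → ℝ)) →L[ℝ] _).comp φ) 0 := by
      refine HasStrictFDerivAt.comp (g := NormedSpace.exp) 0 ?_ φ.hasStrictFDerivAt
      rw [map_zero]
      exact hasStrictFDerivAt_exp_zero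
    have h2 := h1.clm_apply (hasStrictFDerivAt_const D.base 0)
    rw [hEφ]
    refine h2.congr_fderiv ?_
    ext1 x
    have h3 : φ x D.base = x := hψ' x
    simpa using h3
  have h0' : nhds (E 0) ≤ Filter.map E (nhds 0) :=
    (h0.map_nhds_eq_of_surj (by simp)).ge
  refine isOpenMap_iff_nhds_le.2 fun x => ?_
  have hadd : ∀ y, E (x + y) = NormedSpace.exp (ψ x) *ᵥ E y := by
    intro y
    simp only [hE, map_add, S.exp_add (hψ x) (hψ y), Matrix.mulVec_mulVec]
  have h1 : nhds x = Filter.map (x + ·) (nhds 0) := by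
    simp
  have hEx : E x = NormedSpace.exp (ψ x) *ᵥ E 0 := by rw [← hadd, add_zero]
  rw [h1, Filter.map_map, hEx]
  have h2 : E ∘ (x + ·) = (NormedSpace.exp (ψ x) *ᵥ ·) ∘ E := funext hadd
  rw [h2, ← Filter.map_map]
  exact ((isOpenMap_mulVec (Matrix.isUnit_exp _)).nhds_le _).trans (Filter.map_mono h0')

/-- In the chart, y ↦ ψ(y) y is squaring in `hull`. By commutativity its derivative at x is 2ψ(x),
which is onto when ψ(x) is invertible. -/
theorem nhds_le_map_sq (hψ : ∀ x, ψ x ∈ S.hull) (hψ' : ∀ x, ψ x *ᵥ D.base = x) {x}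
    (hx : IsUnit (ψ x)) :
    nhds (ψ x *ᵥ x) ≤ Filter.map (fun y => ψ y *ᵥ y) (nhds x) := by
  let φ : (Fin n → ℝ) →L[ℝ] ((Fin n → ℝ) →L[ℝ] (Fin n → ℝ)) :=
    LinearMap.toContinuousLinearMap ((toEndomorphism n).toLinearMap ∘ₗ ψ)
  have h := (φ.hasStrictFDerivAt (x := x)).clm_apply (hasStrictFDerivAt_id x)
  refine (h.map_nhds_eq_of_surj ?_).ge
  rw [LinearMap.range_eq_top]
  intro y
  obtain ⟨Y, hY⟩ := hx.exists_right_inv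
  refine ⟨(2⁻¹ : ℝ) • Y *ᵥ y, ?_⟩
  have hφ : ∀ z, φ z x = ψ x *ᵥ z := by
    intro z
    change ψ z *ᵥ x = ψ x *ᵥ z
    conv_lhs => rw [← hψ' x, Matrix.mulVec_mulVec, (S.commute_of_mem_hull (hψ z) (hψ x)).eq,
      ← Matrix.mulVec_mulVec, hψ']
  have hφ' : ∀ z, φ x z = ψ x *ᵥ z := fun z => rfl
  simp only [ContinuousLinearMap.coe_coe, _root_.add_apply,
    ContinuousLinearMap.comp_apply, ContinuousLinearMap.flip_apply, ContinuousLinearMap.id_apply,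
    id, hφ, hφ', Matrix.mulVec_smul, Matrix.mulVec_mulVec, hY, Matrix.one_mulVec]
  module

/-- Points with the same image under the chart differ by a period vector, and the span is stable
under adding these. -/
theorem mem_span_of_exp_eq (hc : S.hullOrbit D.base = ⊤) (hψ : ∀ x, ψ x ∈ S.hull)
    (hψ' : ∀ x, ψ x *ᵥ D.base = x) {x y} (hy : y ∈ S.span)
    (h : NormedSpace.exp (ψ x) *ᵥ D.base = NormedSpace.exp (ψ y) *ᵥ D.base) : x ∈ S.span := by
  have h1 := S.eq_of_mulVec_base_eq hc (S.exp_mem_hull (hψ x)) (S.exp_mem_hull (hψ y)) h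
  obtain ⟨t, ht⟩ := exists_eq_of_exp_eq (S.hull_le (hψ x)) (S.hull_le (hψ y)) h1
  obtain ⟨a, u, rfl⟩ := S.mem_span_iff.1 hy
  refine S.mem_span_iff.2 ⟨a, u + t, ?_⟩
  rw [← hψ' x, ht, Matrix.add_mulVec, hψ', ← Matrix.add_mulVec, period_add, add_assoc]

theorem exp_section_logs (hc : S.hullOrbit D.base = ⊤) (hψ : ∀ x, ψ x ∈ S.hull)
    (hψ' : ∀ x, ψ x *ᵥ D.base = x) (a t) :
    NormedSpace.exp (ψ ((S.logs a + D.period t) *ᵥ D.base)) = NormedSpace.exp (S.logs a) := by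
  rw [← S.exp_logs_add_period a t]
  congr 1
  exact S.eq_of_mulVec_base_eq hc (hψ _)
    (S.hull.add_mem (S.logs_mem_hull a) (S.period_mem_hull t)) (hψ' _)

theorem dense_span_of_locallyDense_orbit
    (h : LocallyDense (orbit (S.G : Set (Matrix (Fin n) (Fin n) ℝ)) D.base)) :
    Dense (S.span : Set (Fin n → ℝ)) := by
  have hc := span_eq_top_of_locallyDense h (S.orbit_subset_hullOrbit D.base)
  obtain ⟨ψ, hψ, hψ'⟩ := S.exists_section hc
  set E := fun x => NormedSpace.exp (ψ x) *ᵥ D.base with hE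
  have hEc : Continuous E := continuous_exp_mulVec D.base
  have hEo : IsOpenMap E := S.isOpenMap_exp_mulVec hψ hψ'
  have hQc : Continuous fun y => ψ y *ᵥ y := by
    have h1 : Continuous fun x => toEndomorphism n (ψ x) :=
      LinearMap.continuous_of_finiteDimensional ((toEndomorphism n).toLinearMap ∘ₗ ψ)
    exact h1.clm_apply continuous_id
  have hQ : ∀ X ∈ S.G, X ^ 2 *ᵥ D.base ∈ E '' S.span := by
    intro X hX
    obtain ⟨a, ha⟩ := S.exists_sq_eq_exp_logs (S.mem_closure_iff.2 (.inl hX))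
    refine ⟨_, S.mem_span_iff.2 ⟨a, 0, rfl⟩, ?_⟩
    simp only [hE]
    rw [S.exp_section_logs hc hψ hψ', ha]
  have hψX : ∀ X ∈ S.G, ψ (X *ᵥ D.base) = X := fun X hX =>
    S.eq_of_mulVec_base_eq hc (hψ _) (S.mem_hull hX) (hψ' _)
  have hQX : ∀ X ∈ S.G, ψ (X *ᵥ D.base) *ᵥ (X *ᵥ D.base) = X ^ 2 *ᵥ D.base := fun X hX => by
    rw [hψX X hX, Matrix.mulVec_mulVec, sq]
  obtain ⟨z, hz⟩ := h
  -- The interior point is chosen in the orbit itself: there squaring is locally onto, and the image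
  -- lies in E(span).
  obtain ⟨_, hxU, ⟨X, hX, rfl⟩⟩ := mem_closure_iff_nhds.1 (interior_subset hz) _
    (isOpen_interior.mem_nhds hz)
  have hcl : closure (E '' S.span) ∈ nhds (X ^ 2 *ᵥ D.base) := by
    rw [← hQX X hX]
    have h1 := S.nhds_le_map_sq hψ hψ' (x := X *ᵥ D.base)
      ((hψX X hX).symm ▸ S.isUnit_of_mem hX)
    have h2 := mem_interior_iff_mem_nhds.1 hxU
    refine h1 (Filter.mem_map.2 (Filter.mem_of_superset h2 ?_))
    intro y hy
    refine map_mem_closure (f := fun y => ψ y *ᵥ y) hQc hy ?_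
    rintro _ ⟨Y, hY, rfl⟩
    change ψ (Y *ᵥ D.base) *ᵥ (Y *ᵥ D.base) ∈ _
    rw [hQX Y hY]
    exact hQ Y hY
  obtain ⟨x, hx, hxE⟩ := hQ X hX
  refine S.dense_span_of_locallyDense ⟨x, mem_interior_iff_mem_nhds.2 ?_⟩
  rw [← hxE] at hcl
  refine Filter.mem_of_superset (hEc.continuousAt.preimage_mem_nhds hcl) ?_
  -- Openness of E pulls the closure back, and the preimage of E(span) is the span.
  refine hEo.preimage_closure_subset_closure_preimage.trans (closure_mono ?_)
  rintro y ⟨w, hw, hwy⟩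
  exact S.mem_span_of_exp_eq hc hψ hψ' hw hwy.symm

theorem locallyDense_orbit_of_dense_span (hn : 0 < n)
    (h : Dense (S.span : Set (Fin n → ℝ))) :
    LocallyDense (orbit (S.G : Set (Matrix (Fin n) (Fin n) ℝ)) D.base) := by
  have hld : LocallyDense (S.span : Set (Fin n → ℝ)) := by
    rw [LocallyDense, h.closure_eq, interior_univ]
    exact Set.univ_nonempty
  have hc : S.hullOrbit D.base = ⊤ := by
    refine span_eq_top_of_locallyDense hld fun x hx => ?_
    obtain ⟨a, t, rfl⟩ := S.mem_span_iff.1 hx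
    exact ⟨_, S.hull.add_mem (S.logs_mem_hull a) (S.period_mem_hull t), rfl⟩
  obtain ⟨ψ, hψ, hψ'⟩ := S.exists_section hc
  -- The zero combination is sent to the base vector, which need not be in the orbit of G; all other
  -- points of E(span) not accounted for by the identity come from squares in G.
  refine LocallyDense.of_insert hn (v := D.base) ((hld.image
    (continuous_exp_mulVec (ψ := ψ) D.base) (S.isOpenMap_exp_mulVec hψ hψ')).mono ?_)
  rintro _ ⟨x, hx, rfl⟩
  obtain ⟨a, t, rfl⟩ := S.mem_span_iff.1 hx
  obtain ⟨X, hX, hX2⟩ := S.exists_exp_logs_eq_sq a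
  simp only
  rw [S.exp_section_logs hc hψ hψ', ← hX2]
  rcases S.mem_closure_iff.1 hX with hX | rfl
  · exact .inr ⟨X ^ 2, by rw [sq]; exact S.G.mul_mem hX hX, rfl⟩
  · left; simp

end LogGenerated
end CellSystem

/-! ### Triangular blocks and complex cells -/

/-- The real `2 × 2` matrix of the multiplication by a complex number. -/
def cellMatrix (z : ℂ) : Matrix (Fin 2) (Fin 2) ℝ := !![z.re, -z.im; z.im, z.re]

theorem cellMatrix_injective : Function.Injective cellMatrix := fun z w h => by
  have h0 := congrFun (congrFun h 0) 0
  have h1 := congrFun (congrFun h 1) 0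
  simp only [cellMatrix, of_apply, cons_val', cons_val_zero, cons_val_one, cons_val_fin_one]
    at h0 h1
  exact Complex.ext h0 h1

theorem cellMatrix_zero : cellMatrix 0 = 0 := by
  ext i j; fin_cases i <;> fin_cases j <;> simp [cellMatrix]

theorem mem_complexCells_iff {C : Matrix (Fin 2) (Fin 2) ℝ} :
    C ∈ complexCells ↔ ∃ z, C = cellMatrix z := by
  constructor
  · rintro ⟨α, β, rfl⟩
    -- With multiplication acting on columns, this cell represents α - iβ.
    exact ⟨⟨α, -β⟩, by simp [cellMatrix]⟩
  · rintro ⟨z, rfl⟩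
    exact ⟨z.re, -z.im, by simp [cellMatrix]⟩

/-- Complex `m × m` matrices as real `2m × 2m` matrices. -/
def realify (m : ℕ) :
    Matrix (Fin m) (Fin m) ℂ →ₐ[ℝ] Matrix (Fin m × Fin 2) (Fin m × Fin 2) ℝ :=
  (compAlgEquiv (Fin m) (Fin 2) ℝ ℝ).toAlgHom.comp
    (Algebra.leftMulMatrix Complex.basisOneI).mapMatrix

theorem realify_apply {m : ℕ} (Z : Matrix (Fin m) (Fin m) ℂ) (x y) :
    realify m Z x y = cellMatrix (Z x.1 y.1) x.2 y.2 := by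
  rw [cellMatrix, ← Algebra.leftMulMatrix_complex]
  rfl

theorem cell_realify {m : ℕ} (Z : Matrix (Fin m) (Fin m) ℂ) (i j) :
    cell (realify m Z) i j = cellMatrix (Z i j) := by
  ext a b; exact realify_apply _ _ _

/-- Strictly lower triangular matrices. -/
def IsStrictlyLower {m : ℕ} {R : Type*} [Zero R] (N : Matrix (Fin m) (Fin m) R) : Prop :=
  ∀ i j, i ≤ j → N i j = 0

theorem IsStrictlyLower.mul {m : ℕ} {R : Type*} [Semiring R] {M N : Matrix (Fin m) (Fin m) R}
    (hM : IsStrictlyLower M) (hN : IsStrictlyLower N) : IsStrictlyLower (M * N) := by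
  intro i j hij
  rw [Matrix.mul_apply]
  refine Finset.sum_eq_zero fun k _ => ?_
  rcases le_or_gt i k with h | h
  · rw [hM i k h, zero_mul]
  · rw [hN k j (h.le.trans hij), mul_zero]

theorem IsStrictlyLower.pow_eq_zero {m : ℕ} {R : Type*} [Semiring R]
    {N : Matrix (Fin m) (Fin m) R} (hN : IsStrictlyLower N) : N ^ m = 0 := by
  have key : ∀ k, ∀ i j : Fin m, (i : ℕ) < j + k → (N ^ k) i j = 0 := by
    intro k
    induction k with
    | zero =>
      intro i j hij
      rw [pow_zero, Matrix.one_apply_ne]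
      rintro rfl
      simp at hij
    | succ k ih =>
      intro i j hij
      rw [pow_succ, Matrix.mul_apply]
      refine Finset.sum_eq_zero fun x _ => ?_
      rcases le_or_gt x j with h | h
      · rw [hN x j h, mul_zero]
      · rw [ih i x (by rw [Fin.lt_def] at h; omega), zero_mul]
  ext i j
  exact key m i j (by omega)

theorem mem_triangularBlocks_iff {m : ℕ} {T : Matrix (Fin m) (Fin m) ℝ} :
    T ∈ triangularBlocks m ↔ ∃ μ N, IsStrictlyLower N ∧ T = algebraMap ℝ _ μ + N := by
  constructor
  · rintro ⟨μ, h1, h2⟩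
    refine ⟨μ, T - algebraMap ℝ _ μ, fun i j hij => ?_, by abel⟩
    rcases hij.eq_or_lt with rfl | h
    · simp [h1, Matrix.algebraMap_matrix_apply]
    · simp [h2 i j h, Matrix.algebraMap_matrix_apply, h.ne]
  · rintro ⟨μ, N, hN, rfl⟩
    refine ⟨μ, fun i => by simp [hN i i le_rfl, Matrix.algebraMap_matrix_apply], fun i j h => ?_⟩
    simp [hN i j h.le, Matrix.algebraMap_matrix_apply, h.ne]

/-- Reading cells as complex numbers gives the complex blocks the same scalar-plus-strictly-lower
form as the real ones. -/
theorem mem_complexTriangularBlocks_iff {m : ℕ}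
    {S : Matrix (Fin m × Fin 2) (Fin m × Fin 2) ℝ} :
    S ∈ complexTriangularBlocks m ↔
      ∃ z N, IsStrictlyLower N ∧ S = realify m (algebraMap ℂ _ z + N) := by
  constructor
  · rintro ⟨C, hC, h1, h2, h3⟩
    obtain ⟨z, rfl⟩ := mem_complexCells_iff.1 hC
    have h : ∀ i j, ∃ w, cell S i j = cellMatrix w := by
      intro i j
      rcases lt_trichotomy i j with h | rfl | h
      · exact ⟨0, by rw [h2 i j h, cellMatrix_zero]⟩
      · exact ⟨z, h1 i⟩
      · exact mem_complexCells_iff.1 (h3 i j h)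
    choose Z hZ using h
    refine ⟨z, Matrix.of Z - algebraMap ℂ _ z, fun i j hij => ?_, ?_⟩
    · rcases hij.eq_or_lt with rfl | h
      · have : Z i i = z := cellMatrix_injective ((hZ i i).symm.trans (h1 i))
        simp [this, Matrix.algebraMap_matrix_apply]
      · have : Z i j = 0 :=
          cellMatrix_injective ((hZ i j).symm.trans ((h2 i j h).trans cellMatrix_zero.symm))
        simp [this, Matrix.algebraMap_matrix_apply, h.ne]
    · ext ⟨i, a⟩ ⟨j, b⟩
      rw [realify_apply, add_sub_cancel]
      exact congrFun (congrFun (hZ i j) a) b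
  · rintro ⟨z, N, hN, rfl⟩
    refine ⟨cellMatrix z, mem_complexCells_iff.2 ⟨z, rfl⟩, fun i => ?_, fun i j h => ?_,
      fun i j _ => ?_⟩ <;> rw [cell_realify]
    · simp [hN i i le_rfl, Matrix.algebraMap_matrix_apply]
    · simp [hN i j h.le, Matrix.algebraMap_matrix_apply, h.ne, cellMatrix_zero]
    · exact mem_complexCells_iff.2 ⟨_, rfl⟩

/-! ### The algebra P𝒦P⁻¹ as a cell system -/

section Blocks

variable {n r s : ℕ} (η : Shape n r s)

/-- Families of blocks, real or complex. -/
abbrev Blocks : Type :=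
  (∀ k, Matrix (Fin (η.nn k)) (Fin (η.nn k)) ℝ) × (∀ l, Matrix (Fin (η.mm l)) (Fin (η.mm l)) ℂ)

/-- The block diagonal matrix of a family of blocks, indexed by the block coordinates. -/
def blockSum : Blocks η →ₐ[ℝ] Matrix (BlockIndex η) (BlockIndex η) ℝ :=
  AlgHom.ofLinearMap
    { toFun := fun X => Matrix.fromBlocks (blockDiagonal' X.1) 0 0
        (blockDiagonal' fun l => realify _ (X.2 l))
      map_add' := fun X Y => by
        rw [Matrix.fromBlocks_add, ← blockDiagonal'_add, ← blockDiagonal'_add]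
        simp [Pi.add_def]
      map_smul' := fun c X => by
        simp [Matrix.fromBlocks_smul, ← blockDiagonal'_smul, Pi.smul_def] }
    (by
      simp only [LinearMap.coe_mk, AddHom.coe_mk, Prod.fst_one, Prod.snd_one, Pi.one_apply, map_one]
      rw [← Matrix.fromBlocks_one, ← blockDiagonal'_one, ← blockDiagonal'_one]
      rfl)
    (fun X Y => by
      simp [Matrix.fromBlocks_multiply, ← blockDiagonal'_mul, Pi.mul_def])

theorem blockSum_apply (X : Blocks η) : blockSum η X =
    Matrix.fromBlocks (blockDiagonal' X.1) 0 0 (blockDiagonal' fun l => realify _ (X.2 l)) := rfl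

theorem blockSum_mulVec_inl (X : Blocks η) (w : BlockIndex η → ℝ) (k i) :
    (blockSum η X *ᵥ w) (.inl ⟨k, i⟩) = ∑ j, X.1 k i j * w (.inl ⟨k, j⟩) := by
  simp only [Matrix.mulVec, dotProduct, Fintype.sum_sum_type, blockSum_apply, fromBlocks_apply₁₁,
    fromBlocks_apply₁₂, Matrix.zero_apply, zero_mul, Finset.sum_const_zero, add_zero,
    Fintype.sum_sigma]
  rw [Finset.sum_eq_single k]
  · simp [blockDiagonal'_apply_eq]
  · intro k' _ hk'
    exact Finset.sum_eq_zero fun j _ => by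
      rw [blockDiagonal'_apply_ne _ _ _ hk'.symm, zero_mul]
  · simp

theorem blockSum_mulVec_inr (X : Blocks η) (w : BlockIndex η → ℝ) (l i) :
    (blockSum η X *ᵥ w) (.inr ⟨l, i⟩) =
      ∑ j, ∑ b, cellMatrix (X.2 l i.1 j) i.2 b * w (.inr ⟨l, (j, b)⟩) := by
  simp only [Matrix.mulVec, dotProduct, Fintype.sum_sum_type, blockSum_apply, fromBlocks_apply₂₂,
    fromBlocks_apply₂₁, Matrix.zero_apply, zero_mul, Finset.sum_const_zero, zero_add,
    Fintype.sum_sigma]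
  rw [Finset.sum_eq_single l]
  · simp [blockDiagonal'_apply_eq, realify_apply, Fintype.sum_prod_type]
  · intro l' _ hl'
    exact Finset.sum_eq_zero fun j _ => by
      rw [blockDiagonal'_apply_ne _ _ _ hl'.symm, zero_mul]
  · simp

/-- Families of scalar blocks. -/
def scalarBlocks : ((Fin r → ℝ) × (Fin s → ℂ)) →ₐ[ℝ] Blocks η :=
  ((AlgHom.pi fun k => (Algebra.ofId ℝ _).comp (Pi.evalAlgHom ℝ _ k)).comp
    (AlgHom.fst ℝ _ _)).prod
  ((AlgHom.pi fun l => ((Algebra.ofId ℂ _).restrictScalars ℝ).comp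
    (Pi.evalAlgHom ℝ _ l)).comp (AlgHom.snd ℝ _ _))

theorem scalarBlocks_fst (d k) : (scalarBlocks η d).1 k = algebraMap ℝ _ (d.1 k) := rfl

theorem scalarBlocks_snd (d l) : (scalarBlocks η d).2 l = algebraMap ℂ _ (d.2 l) := rfl

/-- Families of strictly lower triangular blocks. -/
def strictBlocks : Submodule ℝ (Blocks η) where
  carrier := {X | (∀ k, IsStrictlyLower (X.1 k)) ∧ ∀ l, IsStrictlyLower (X.2 l)}
  zero_mem' := ⟨fun _ _ _ _ => rfl, fun _ _ _ _ => rfl⟩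
  add_mem' := fun {X Y} hX hY =>
    ⟨fun k i j h => by simp [hX.1 k i j h, hY.1 k i j h],
      fun k i j h => by simp [hX.2 k i j h, hY.2 k i j h]⟩
  smul_mem' := fun c X hX =>
    ⟨fun k i j h => by simp [hX.1 k i j h], fun k i j h => by simp [hX.2 k i j h]⟩

theorem mul_mem_strictBlocks {X Y} (hX : X ∈ strictBlocks η) (hY : Y ∈ strictBlocks η) :
    X * Y ∈ strictBlocks η :=
  ⟨fun k => (hX.1 k).mul (hY.1 k), fun l => (hX.2 l).mul (hY.2 l)⟩

theorem scalarBlocks_mul_mem {X} (d) (hX : X ∈ strictBlocks η) :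
    scalarBlocks η d * X ∈ strictBlocks η := by
  refine ⟨fun k i j h => ?_, fun l i j h => ?_⟩
  · simp [scalarBlocks_fst, Algebra.algebraMap_eq_smul_one, hX.1 k i j h]
  · simp [scalarBlocks_snd, Algebra.algebraMap_eq_smul_one, hX.2 l i j h]

theorem scalarBlocks_commute (d X) : Commute (scalarBlocks η d) X := by
  refine Prod.ext (funext fun k => ?_) (funext fun l => ?_)
  · exact Algebra.commutes (d.1 k) (X.1 k)
  · exact Algebra.commutes (d.2 l) (X.2 l)

theorem isNilpotent_of_mem_strictBlocks {X} (hX : X ∈ strictBlocks η) : IsNilpotent X := by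
  -- A common exponent, at least as large as every block size.
  refine ⟨∑ k, η.nn k + ∑ l, η.mm l, Prod.ext (funext fun k => ?_) (funext fun l => ?_)⟩
  · have := Finset.single_le_sum (fun k _ => Nat.zero_le (η.nn k)) (Finset.mem_univ k)
    exact pow_eq_zero_of_le (by omega) (hX.1 k).pow_eq_zero
  · have := Finset.single_le_sum (fun l _ => Nat.zero_le (η.mm l)) (Finset.mem_univ l)
    exact pow_eq_zero_of_le (by omega) (hX.2 l).pow_eq_zero

/-- The base vector `u₀` in block coordinates. -/
def blockBase : BlockIndex η → ℝ := fun x => uZero η (blockEquiv η x)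

theorem blockBase_inl (k i) :
    blockBase η (.inl ⟨k, i⟩) = if i.val = 0 then (1 : ℝ) else 0 := by
  simp [blockBase, uZero]

theorem blockBase_inr (l i) :
    blockBase η (.inr ⟨l, i⟩) = if i.1.val = 0 ∧ i.2 = 0 then (1 : ℝ) else 0 := by
  simp [blockBase, uZero]

theorem scalarBlocks_mulVec_inl (d k i) :
    (blockSum η (scalarBlocks η d) *ᵥ blockBase η) (.inl ⟨k, i⟩) =
      if i.val = 0 then d.1 k else 0 := by
  rw [blockSum_mulVec_inl, Finset.sum_eq_single i]
  · simp [scalarBlocks_fst, blockBase_inl, Matrix.algebraMap_matrix_apply]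
  · intro j _ hj
    simp [scalarBlocks_fst, Matrix.algebraMap_matrix_apply, hj.symm]
  · simp

theorem scalarBlocks_mulVec_inr (d l i) :
    (blockSum η (scalarBlocks η d) *ᵥ blockBase η) (.inr ⟨l, i⟩) =
      if i.1.val = 0 then (if i.2 = 0 then (d.2 l).re else (d.2 l).im) else 0 := by
  rw [blockSum_mulVec_inr, Finset.sum_eq_single i.1]
  · obtain ⟨i, a⟩ := i
    fin_cases a <;> simp [scalarBlocks_snd, blockBase_inr, cellMatrix,
      Matrix.algebraMap_matrix_apply]
  · intro j _ hj
    simp [scalarBlocks_snd, Matrix.algebraMap_matrix_apply, hj.symm, cellMatrix_zero]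
  · simp

/-- A strictly lower triangular block has zero first row, while the leading coordinates of the left
side are the components of d. -/
theorem eq_zero_of_blockSum_mulVec {d X} (hX : X ∈ strictBlocks η) {w : BlockIndex η → ℝ}
    (h : blockSum η (scalarBlocks η d) *ᵥ blockBase η = blockSum η X *ᵥ w) : d = 0 := by
  refine Prod.ext (funext fun k => ?_) (funext fun l => ?_)
  · have h1 := congrFun h (.inl ⟨k, ⟨0, η.nn_pos k⟩⟩)
    rw [scalarBlocks_mulVec_inl, blockSum_mulVec_inl] at h1
    simpa [hX.1 k ⟨0, η.nn_pos k⟩ _ (Nat.zero_le _)] using h1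
  · have h1 : ∀ a : Fin 2, (if a = 0 then (d.2 l).re else (d.2 l).im) = 0 := by
      intro a
      have h2 := congrFun h (.inr ⟨l, (⟨0, η.mm_pos l⟩, a)⟩)
      rw [scalarBlocks_mulVec_inr, blockSum_mulVec_inr] at h2
      simpa only [hX.2 l ⟨0, η.mm_pos l⟩ _ (Nat.zero_le _), cellMatrix_zero, Matrix.zero_apply,
        zero_mul, Finset.sum_const_zero, if_true] using h2
    exact Complex.ext (by simpa using h1 0) (by simpa using h1 1)

/-- The embedding of families of blocks in `n × n` matrices, conjugated by `P`. -/
def blockHom (P : GL (Fin n) ℝ) : Blocks η →ₐ[ℝ] Matrix (Fin n) (Fin n) ℝ :=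
  (AlgHom.ofLinearMap (LinearMap.mulLeft ℝ P.val ∘ₗ LinearMap.mulRight ℝ (P⁻¹).val)
    (by simp) (fun X Y => by
      simp only [LinearMap.comp_apply, LinearMap.mulLeft_apply, LinearMap.mulRight_apply]
      simp only [mul_assoc, Units.inv_mul_cancel_left])).comp
    ((Matrix.reindexAlgEquiv ℝ ℝ (blockEquiv η)).toAlgHom.comp (blockSum η))

theorem blockHom_apply (P : GL (Fin n) ℝ) (X) : blockHom η P X =
    P.val * Matrix.reindex (blockEquiv η) (blockEquiv η) (blockSum η X) * (P⁻¹).val := by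
  rw [mul_assoc]; rfl

theorem reindex_mulVec_comp (M : Matrix (BlockIndex η) (BlockIndex η) ℝ) (w : Fin n → ℝ) :
    (Matrix.reindex (blockEquiv η) (blockEquiv η) M *ᵥ w) ∘ blockEquiv η =
      M *ᵥ (w ∘ blockEquiv η) := by
  rw [Matrix.reindex_apply, Matrix.submatrix_mulVec_equiv]
  ext x
  simp

theorem mulVec_injective_of_units (P : GL (Fin n) ℝ) :
    Function.Injective (P.val *ᵥ · : (Fin n → ℝ) → _) :=
  Matrix.mulVec_injective_of_isUnit P.isUnit

theorem blockHom_mulVec (P : GL (Fin n) ℝ) (X) (w) : blockHom η P X *ᵥ w =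
    P.val *ᵥ (Matrix.reindex (blockEquiv η) (blockEquiv η) (blockSum η X) *ᵥ
      ((P⁻¹).val *ᵥ w)) := by
  rw [blockHom_apply, Matrix.mulVec_mulVec, Matrix.mulVec_mulVec, mul_assoc]

theorem inv_mulVec_vZero (P : GL (Fin n) ℝ) : (P⁻¹).val *ᵥ vZero η P = uZero η := by
  rw [vZero, Matrix.mulVec_mulVec, Units.inv_mul, Matrix.one_mulVec]

/-- The cell system of the algebra `P 𝒦 P⁻¹`. -/
def cellSystem (P : GL (Fin n) ℝ) : CellSystem n r s where
  diag := (blockHom η P).comp (scalarBlocks η)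
  nil := (strictBlocks η).map (blockHom η P).toLinearMap
  base := vZero η P
  mul_mem_nil := by
    rintro _ ⟨X, hX, rfl⟩ _ ⟨Y, hY, rfl⟩
    exact ⟨X * Y, mul_mem_strictBlocks η hX hY, map_mul (blockHom η P) X Y⟩
  diag_mul_mem_nil := by
    rintro d _ ⟨X, hX, rfl⟩
    exact ⟨scalarBlocks η d * X, scalarBlocks_mul_mem η d hX, map_mul (blockHom η P) _ X⟩
  diag_commute := by
    rintro d _ ⟨X, hX, rfl⟩
    exact (scalarBlocks_commute η d X).map (blockHom η P)
  isNilpotent := by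
    rintro _ ⟨X, hX, rfl⟩
    exact (isNilpotent_of_mem_strictBlocks η hX).map (blockHom η P)
  eq_zero_of_mulVec := by
    rintro d _ ⟨X, hX, rfl⟩ w h
    change blockHom η P (scalarBlocks η d) *ᵥ vZero η P = blockHom η P X *ᵥ w at h
    rw [blockHom_mulVec, blockHom_mulVec, inv_mulVec_vZero] at h
    have h1 := congrArg (· ∘ blockEquiv η) (mulVec_injective_of_units P h)
    simp only [reindex_mulVec_comp] at h1
    exact eq_zero_of_blockSum_mulVec η hX h1

/-- In a complex block, i · 1 = i moves the leading 1 to the second place; this identifies the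
abstract periods with the vectors of H. -/
theorem cellSystem_imag_mulVec (P : GL (Fin n) ℝ) (l) :
    (cellSystem η P).imag l *ᵥ (cellSystem η P).base = P.val *ᵥ fVec η l := by
  change blockHom η P (scalarBlocks η _) *ᵥ vZero η P = _
  rw [blockHom_mulVec, inv_mulVec_vZero]
  congr 1
  refine (blockEquiv η).surjective.injective_comp_right ?_
  change _ ∘ blockEquiv η = _ ∘ blockEquiv η
  rw [reindex_mulVec_comp]
  ext x
  change (blockSum η _ *ᵥ blockBase η) x = _
  rcases x with ⟨k, i⟩ | ⟨l', i, a⟩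
  · rw [scalarBlocks_mulVec_inl]
    simp [fVec]
  · rw [scalarBlocks_mulVec_inr]
    rcases eq_or_ne l' l with rfl | hl
    · fin_cases a <;> simp [fVec]
    · simp [fVec, hl]

theorem mem_conjNormalMatrices_iff (P : GL (Fin n) ℝ) {X} :
    X ∈ conjNormalMatrices η P ↔ X ∈ (cellSystem η P).alg := by
  constructor
  · rintro ⟨_, ⟨T, S, hT, hS, rfl⟩, rfl⟩
    simp only [mem_triangularBlocks_iff] at hT
    simp only [mem_complexTriangularBlocks_iff] at hS
    choose μ M hM hTM using hT
    choose z N hN hSN using hS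
    refine ⟨(μ, z), blockHom η P (M, N), ⟨_, ⟨hM, hN⟩, rfl⟩, ?_⟩
    change _ = blockHom η P (scalarBlocks η _) + _
    rw [← map_add, blockHom_apply, blockSum_apply]
    obtain rfl := funext hTM
    obtain rfl := funext hSN
    rfl
  · rintro ⟨d, _, ⟨Y, hY, rfl⟩, rfl⟩
    change blockHom η P (scalarBlocks η d) + blockHom η P Y ∈ _
    rw [← map_add, blockHom_apply, blockSum_apply]
    refine ⟨_, ⟨_, _, fun k => ?_, fun l => ?_, rfl⟩, rfl⟩
    · exact mem_triangularBlocks_iff.2 ⟨d.1 k, Y.1 k, hY.1 k, rfl⟩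
    · exact mem_complexTriangularBlocks_iff.2 ⟨d.2 l, Y.2 l, hY.2 l, rfl⟩

end Blocks

end AbelianSemigroup

end

theorem theorem1p3 {n r s p : ℕ} (hn : 0 < n) (η : AbelianSemigroup.Shape n r s)
    (G : Subsemigroup (Matrix (Fin n) (Fin n) ℝ))
    (hcomm : ∀ X ∈ G, ∀ Y ∈ G, X * Y = Y * X)
    (P : GL (Fin n) ℝ)
    (hP : ∀ X ∈ G, (P⁻¹).val * X * P.val ∈ AbelianSemigroup.normalMatrices η)
    (A B : Fin p → Matrix (Fin n) (Fin n) ℝ)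
    -- `A` generates `G`, as a semigroup or as a semigroup with identity
    (hgen : Subsemigroup.closure (Set.range A) = G ∨
      (Submonoid.closure (Set.range A)).toSubsemigroup = G)
    (hB : ∀ k, B k ∈ AbelianSemigroup.gSet η P G)
    (hAB : ∀ k, A k ^ 2 = NormedSpace.exp (B k)) :
    -- the formula for `g²_{v₀}`
    (1 ∈ G →
      AbelianSemigroup.orbit (AbelianSemigroup.gSqSet η P G) (AbelianSemigroup.vZero η P) =
        AbelianSemigroup.additiveSpan
          (fun k => (B k).mulVec (AbelianSemigroup.vZero η P))
          (fun l => P.val.mulVec (AbelianSemigroup.fVec η l))) ∧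
    List.TFAE [
      AbelianSemigroup.LocallyHypercyclic G,
      AbelianSemigroup.LocallyDense
        (AbelianSemigroup.orbit (G : Set (Matrix (Fin n) (Fin n) ℝ))
          (AbelianSemigroup.vZero η P)),
      -- `g²_{v₀}` is an additive semigroup and is dense
      (∀ x ∈ AbelianSemigroup.orbit (AbelianSemigroup.gSqSet η P G)
          (AbelianSemigroup.vZero η P),
        ∀ y ∈ AbelianSemigroup.orbit (AbelianSemigroup.gSqSet η P G)
          (AbelianSemigroup.vZero η P),
        x + y ∈ AbelianSemigroup.orbit (AbelianSemigroup.gSqSet η P G)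
          (AbelianSemigroup.vZero η P)) ∧
      Dense (AbelianSemigroup.orbit (AbelianSemigroup.gSqSet η P G)
        (AbelianSemigroup.vZero η P)),
      -- `∑ₖ ℕ Bₖ v₀ + ∑ₗ 2πℤ P f^{(l)}`, an additive semigroup by construction, is dense
      Dense (AbelianSemigroup.additiveSpan
          (fun k => (B k).mulVec (AbelianSemigroup.vZero η P))
          (fun l => P.val.mulVec (AbelianSemigroup.fVec η l)) : Set (Fin n → ℝ))] := by
  let D := AbelianSemigroup.cellSystem η P
  have hmem : ∀ X ∈ G, X ∈ D.alg := fun X hX =>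
    (AbelianSemigroup.mem_conjNormalMatrices_iff η P).1 ⟨_, hP X hX, by simp [mul_assoc]⟩
  let S : D.LogGenerated p :=
    { G := G
      A := A
      B := B
      comm := hcomm
      mem_alg := hmem
      gen := hgen
      exp_B_mem := fun k => (hB k).1
      B_mem_alg := fun k => (AbelianSemigroup.mem_conjNormalMatrices_iff η P).1 (hB k).2
      sq_eq_exp := hAB }
  have hspan : AbelianSemigroup.additiveSpan
      (fun k => (B k).mulVec (AbelianSemigroup.vZero η P))
      (fun l => P.val.mulVec (AbelianSemigroup.fVec η l)) = S.span := by
    simp only [← AbelianSemigroup.cellSystem_imag_mulVec]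
    rfl
  have hsq : AbelianSemigroup.gSqSet η P G = S.sqLogs := by
    ext X
    exact and_comm.trans (and_congr_left' (AbelianSemigroup.mem_conjNormalMatrices_iff η P))
  rw [hspan, hsq]
  refine ⟨S.orbit_sqLogs_eq, ?_⟩
  tfae_have 2 → 1 := fun h => ⟨_, h⟩
  tfae_have 1 → 2 := fun ⟨v, hv⟩ => S.locallyDense_base hv
  tfae_have 2 → 4 := S.dense_span_of_locallyDense_orbit
  tfae_have 4 → 2 := S.locallyDense_orbit_of_dense_span hn
  tfae_have 3 → 4 := fun h => h.2.mono S.orbit_sqLogs_subset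
  tfae_have 4 → 3 := by
    refine fun h => ⟨?_, S.dense_orbit_sqLogs hn h⟩
    rintro _ ⟨X, hX, rfl⟩ _ ⟨Y, hY, rfl⟩
    exact ⟨X + Y, S.add_mem_sqLogs hX hY, Matrix.add_mulVec _ _ _⟩
  tfae_finish
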